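/- Let $\Gamma\subset PSL(2,\mathbb R)$ be a discrete group such that $M=\Gamma\backslash\mathbb H$ has finite hyperbolic area (conic points are allowed), let $\pi_\Gamma:\mathbb H\to M$ be the projection, and let $S^*M=\Gamma\backslash S^*\mathbb H$ be the unit cosphere bundle, with geodesic flow $\exp(tV)$. Assume that the group $\Gamma_\infty$ of all elements of $\Gamma$ fixing $\infty\in\partial\mathbb H=\mathbb R\cup\{\infty\}$ is generated by $z\mapsto z+1$. Let $R\in\mathbb R$ be such that $(r,\theta)\mapsto\pi_\Gamma\big(\frac{\theta+ie^r}{2\pi}\big)$ is injective on $(R,\infty)\times\mathbb R/2\pi\mathbb Z$; its image $\mathcal C_j$ is the corresponding cusp region with canonical coordinates $(r,\theta)$. Let $\nu>0$, and write $\begin{pmatrix}a&b\\c&d\end{pmatrix}\in SL(2,\mathbb R)$ for a matrix representing $\gamma\in\Gamma$. (1) For a coset $\gamma\Gamma_\infty\in\Gamma/\Gamma_\infty$ the point $\gamma(\infty)=a/c$ (equal to $\infty$ if $c=0$) and the number $a^2+c^2$ depend only on the coset; the points $a/c$ are distinct for different cosets; and $$\hat\mu=\sum_{\gamma\Gamma_\infty\in\Gamma/\Gamma_\infty}\frac{\delta_{a/c}}{(a^2+c^2)^{2\nu+1}}$$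 is a finite measure on $\partial\mathbb H$. For every $\gamma\in\Gamma$ and every Borel set $A\subset\partial\mathbb H$, $$\hat\mu(\gamma(A))=\int_A|\gamma'_{\mathbb B}(q)|^{2\nu+1}\,d\hat\mu(q),$$ where $\gamma'_{\mathbb B}(q)$ is the derivative of $\gamma$ at $q$ in the ball model, $\mathbb H$ being identified with the unit disk by $z\mapsto(z-i)/(z+i)$. (2) There is exactly one Radon measure $\mu_{j\nu}$ on $S^*M$ such that for every continuous compactly supported function $f$ on $S^*M$ $$\int f\,d\mu_{j\nu}=\lim_{t\to+\infty}e^{-2\nu t}\int_{\mathcal C_j}e^{2\nu r}\,(f\circ\exp(tV))(r,\theta,p_r=-1,p_\theta=0)\,dr\,d\theta .$$ (3) Let $\mathcal T(q_1,q_2,t)\in S^*\mathbb H$, for $q_1\ne q_2$ in $\partial\mathbb H$ and $t\in\mathbb R$, be the point and unit covector at time $t$ of the unit speed geodesic of $\mathbb H$ from $q_1$ to $q_2$ whose point at time $0$ is its point closest to $i$. The measure $\mu_{j\nu}$ has exactly one lift $\mu'$ to $S^*\mathbb H$ (a Borel measure such that $\mu'(A)=\mu_{j\nu}(\pi(A))$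 for every Borel set $A$ on which the projection $\pi:S^*\mathbb H\to S^*M$ is injective), and in the coordinates $(q_1,q_2,t)$ given by $\mathcal T$ it is $$\mu'=(2\pi)^{2\nu+1}\,\tilde\mu\times e^{-2\nu t}\,dt,\qquad \tilde\mu=|q_1-q_2|^{-2(\nu+1)}\,|q_1+i|^{2(\nu+1)}\,|q_2+i|^{2\nu}\;\hat\mu\times dq_2 ,$$ where $dq_2$ is Lebesgue measure on $\mathbb R$ (so $q_2=\infty$ has measure zero) and the density is extended by continuity to $q_1=\infty$, where it equals $|q_2+i|^{2\nu}$. -/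

import Mathlib

open MeasureTheory Set Filter Topology
open scoped MatrixGroups UpperHalfPlane OnePoint

namespace CuspLift

noncomputable section

/-! ### The cosphere bundle of the hyperbolic plane -/

/-- The unit cosphere bundle `S*ℍ`. A covector `ξ₁ dx + ξ₂ dy` at `z` is written as the complex
number `ξ = ξ₁ + i ξ₂`; its length for the hyperbolic metric `(dx² + dy²) / y²` is `y |ξ|`.
The metric identifies a tangent vector `v` at `z` with the covector `v / y²`. -/
def Cosphere : Type := {p : ℍ × ℂ // p.1.im * ‖p.2‖ = 1}

namespace Cosphere

instance : TopologicalSpace Cosphere :=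
  inferInstanceAs (TopologicalSpace {p : ℍ × ℂ // p.1.im * ‖p.2‖ = 1})

instance : MeasurableSpace Cosphere := borel Cosphere

instance : BorelSpace Cosphere := ⟨rfl⟩

/-- The base point of a covector. -/
def pt (ρ : Cosphere) : ℍ := ρ.1.1

/-- The fibre coordinate of a covector. -/
def cov (ρ : Cosphere) : ℂ := ρ.1.2

theorem ext' {ρ σ : Cosphere} (h₁ : ρ.pt = σ.pt) (h₂ : ρ.cov = σ.cov) : ρ = σ :=
  Subtype.ext (Prod.ext h₁ h₂)

end Cosphere

/-- The factor `c z + d` of `g = (a b; c d)`; the derivative of `g` at `z` is `(c z + d)⁻²`. -/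
def den (g : SL(2, ℝ)) (z : ℍ) : ℂ := (g 1 0 : ℂ) * z + (g 1 1 : ℂ)

theorem den_eq (g : SL(2, ℝ)) (z : ℍ) :
    den g z = UpperHalfPlane.denom (Matrix.SpecialLinearGroup.mapGL ℝ g) z := by
  simp [den, UpperHalfPlane.denom]

theorem den_ne_zero (g : SL(2, ℝ)) (z : ℍ) : den g z ≠ 0 := by
  rw [den_eq]; exact UpperHalfPlane.denom_ne_zero _ _

theorem coe_smul_eq (g : SL(2, ℝ)) (z : ℍ) :
    ((g • z : ℍ) : ℂ) = ((g 0 0 : ℂ) * z + (g 0 1 : ℂ)) / den g z := by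
  simpa [den] using UpperHalfPlane.coe_specialLinearGroup_apply g z

theorem im_smul_eq (g : SL(2, ℝ)) (z : ℍ) : (g • z).im = z.im / ‖den g z‖ ^ 2 := by
  rw [den_eq, ← Complex.normSq_eq_norm_sq, MulAction.compHom_smul_def,
    UpperHalfPlane.im_smul_eq_div_normSq]
  simp

theorem den_mul (g h : SL(2, ℝ)) (z : ℍ) : den (g * h) z = den g (h • z) * den h z := by
  have h0 := den_ne_zero h z
  have h1 : den g (h • z) * den h z =
      (g 1 0 : ℂ) * ((h 0 0 : ℂ) * z + (h 0 1 : ℂ)) + (g 1 1 : ℂ) * den h z := by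
    rw [den, coe_smul_eq]; field_simp
  rw [h1]
  simp only [den, Matrix.SpecialLinearGroup.coe_mul, Matrix.mul_apply, Fin.sum_univ_two]
  push_cast; ring

/-- `SL(2, ℝ)` acts on `S*ℍ` by push-forward of covectors: tangent vectors are multiplied by the
derivative `(c z + d)⁻²`, hence covectors by the complex conjugate of `(c z + d)²`. -/
instance : MulAction SL(2, ℝ) Cosphere where
  smul g ρ := ⟨(g • ρ.pt, ρ.cov * (starRingEnd ℂ (den g ρ.pt)) ^ 2), by
    have h := ρ.2
    have h0 : ‖den g ρ.pt‖ ≠ 0 := norm_ne_zero_iff.2 (den_ne_zero _ _)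
    change (g • ρ.pt).im * ‖ρ.cov * (starRingEnd ℂ (den g ρ.pt)) ^ 2‖ = 1
    rw [im_smul_eq, norm_mul, norm_pow, Complex.norm_conj]
    change ρ.pt.im * ‖ρ.cov‖ = 1 at h
    field_simp
    exact h⟩
  one_smul ρ := Cosphere.ext' (one_smul _ _) (by
    change ρ.cov * (starRingEnd ℂ (den 1 ρ.pt)) ^ 2 = ρ.cov
    simp [den])
  mul_smul g h ρ := Cosphere.ext' (mul_smul _ _ _) (by
    change ρ.cov * (starRingEnd ℂ (den (g * h) ρ.pt)) ^ 2 =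
      ρ.cov * (starRingEnd ℂ (den h ρ.pt)) ^ 2 * (starRingEnd ℂ (den g (h • ρ.pt))) ^ 2
    rw [den_mul, map_mul]; ring)

theorem smul_pt (g : SL(2, ℝ)) (ρ : Cosphere) : (g • ρ).pt = g • ρ.pt := rfl

theorem smul_cov (g : SL(2, ℝ)) (ρ : Cosphere) :
    (g • ρ).cov = ρ.cov * (starRingEnd ℂ (den g ρ.pt)) ^ 2 := rfl

/-! ### Geodesics and the geodesic flow -/

/-- The unit speed geodesic `t ↦ i eᵗ`, from `0` to `∞`, together with its unit covector
(the velocity `i eᵗ` divided by `y² = e²ᵗ`). -/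
def verticalGeodesic (t : ℝ) : Cosphere :=
  ⟨(⟨⟨0, Real.exp t⟩, Real.exp_pos t⟩, ⟨0, Real.exp (-t)⟩), by
    have : (⟨0, Real.exp (-t)⟩ : ℂ) = (Real.exp (-t) : ℂ) * Complex.I := by
      apply Complex.ext <;> simp [-Complex.ofReal_exp]
    change Real.exp t * ‖(⟨0, Real.exp (-t)⟩ : ℂ)‖ = 1
    rw [this, norm_mul, Complex.norm_I, Complex.norm_real, Real.norm_of_nonneg (Real.exp_pos _).le,
      mul_one, ← Real.exp_add, add_neg_cancel, Real.exp_zero]⟩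

/-- The unit speed geodesics of the half-plane, with their unit covectors: they are the images
of `verticalGeodesic` under `SL(2, ℝ)`. The geodesic attached to `g` goes from `g 0` to `g ∞`. -/
def geodesic (g : SL(2, ℝ)) (t : ℝ) : Cosphere := g • verticalGeodesic t

theorem isometry_geodesic (g : SL(2, ℝ)) : Isometry fun t => (geodesic g t).pt :=
  (isometry_smul ℍ g).comp (UpperHalfPlane.isometry_vertical_line 0)

theorem smul_geodesic (g h : SL(2, ℝ)) (t : ℝ) : g • geodesic h t = geodesic (g * h) t :=
  (mul_smul _ _ _).symm

/-- Every unit covector lies on a geodesic. -/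
theorem exists_geodesic (ρ : Cosphere) : ∃ g : SL(2, ℝ), geodesic g 0 = ρ := by
  obtain ⟨w, hw⟩ := IsAlgClosed.exists_pow_nat_eq
    (-Complex.I * (ρ.pt.im * ρ.cov)) (n := 2) (by norm_num)
  have hy := ρ.pt.im_pos
  have hρ : ρ.pt.im * ‖ρ.cov‖ = 1 := ρ.2
  have hn : ‖w‖ = 1 := by
    have : ‖w‖ ^ 2 = 1 := by
      rw [← norm_pow, hw]; simp [abs_of_pos hy, hρ]
    exact (pow_eq_one_iff_of_nonneg (norm_nonneg w) two_ne_zero).1 this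
  have hdet : w.re * w.re + w.im * w.im = 1 := by
    have := Complex.normSq_eq_norm_sq w
    rw [hn, Complex.normSq_apply] at this; simpa using this
  let k : SL(2, ℝ) := ⟨!![w.re, w.im; -w.im, w.re], by
    rw [Matrix.det_fin_two_of]; linarith⟩
  have hv : (verticalGeodesic 0).pt = UpperHalfPlane.I := by
    apply UpperHalfPlane.ext; apply Complex.ext <;> simp [verticalGeodesic, Cosphere.pt]
  have hvc : (verticalGeodesic 0).cov = Complex.I := by
    apply Complex.ext <;> simp [verticalGeodesic, Cosphere.cov]
  have hkd : den k UpperHalfPlane.I = starRingEnd ℂ w := by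
    apply Complex.ext <;> simp [den, k]
  have hw0 : w ≠ 0 := by rintro rfl; simp at hn
  have hk : k • UpperHalfPlane.I = UpperHalfPlane.I := by
    apply UpperHalfPlane.ext
    rw [coe_smul_eq, hkd, div_eq_iff (by simpa using hw0)]
    apply Complex.ext <;> simp [k]
  refine ⟨ρ.pt.toSL2R * k, Cosphere.ext' ?_ ?_⟩
  · rw [geodesic, smul_pt, hv, mul_smul, hk, UpperHalfPlane.toSL2R_smul_I]
  · rw [geodesic, smul_cov, hv, hvc, den_mul, hk, hkd]
    have hd : den ρ.pt.toSL2R UpperHalfPlane.I = ((1 / √ρ.pt.im : ℝ) : ℂ) := by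
      simp [den]
    have hs : ((√ρ.pt.im : ℝ) : ℂ) ^ 2 = (ρ.pt.im : ℂ) := by
      rw [← Complex.ofReal_pow, Real.sq_sqrt hy.le]
    have hy' : (ρ.pt.im : ℂ) ≠ 0 := by exact_mod_cast hy.ne'
    rw [hd, map_mul, Complex.conj_ofReal, Complex.conj_conj, mul_pow, hw]
    push_cast
    rw [div_pow, hs]
    field_simp
    simp

/-- A geodesic is determined by its initial covector. -/
theorem geodesic_congr {g h : SL(2, ℝ)} (H : geodesic g 0 = geodesic h 0) (t : ℝ) :
    geodesic g t = geodesic h t := by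
  have key : ∀ k : SL(2, ℝ), k • verticalGeodesic 0 = verticalGeodesic 0 →
      k • verticalGeodesic t = verticalGeodesic t := by
    intro k hk
    have h1 : ((k • (verticalGeodesic 0).pt : ℍ) : ℂ) = ((verticalGeodesic 0).pt : ℂ) := by
      rw [← smul_pt, hk]
    have h2 : (verticalGeodesic 0).cov * (starRingEnd ℂ (den k (verticalGeodesic 0).pt)) ^ 2 =
        (verticalGeodesic 0).cov := by rw [← smul_cov, hk]
    have e1 : ((verticalGeodesic 0).pt : ℂ) = Complex.I := by
      apply Complex.ext <;> simp [verticalGeodesic, Cosphere.pt]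
    have e2 : (verticalGeodesic 0).cov = Complex.I := by
      apply Complex.ext <;> simp [verticalGeodesic, Cosphere.cov]
    rw [coe_smul_eq, div_eq_iff (den_ne_zero _ _), e1] at h1
    rw [e2, mul_eq_left₀ Complex.I_ne_zero] at h2
    simp only [den, e1] at h1 h2
    have r1 := congrArg Complex.re h1
    have r2 := congrArg Complex.im h1
    have r3 := congrArg Complex.re h2
    have r4 := congrArg Complex.im h2
    simp [pow_two] at r1 r2 r3 r4
    have hc : k 1 0 = 0 := by
      by_contra hc
      have hd : k 1 1 = 0 := by
        have : k 1 0 * k 1 1 = 0 := by linarith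
        exact (mul_eq_zero.1 this).resolve_left hc
      rw [hd] at r3; nlinarith [mul_self_nonneg (k 1 0)]
    have hb : k 0 1 = 0 := by rw [r1, hc, neg_zero]
    have hd : k 1 1 * k 1 1 = 1 := by rw [hc] at r3; linarith
    have hd0 : k 1 1 ≠ 0 := by rintro h; simp [h] at hd
    apply Cosphere.ext'
    · apply UpperHalfPlane.ext
      rw [smul_pt, coe_smul_eq, div_eq_iff (den_ne_zero _ _)]
      simp [den, hc, hb, r2, mul_comm]
    · rw [smul_cov]
      have : ((k 1 1 : ℝ) : ℂ) ^ 2 = 1 := by rw [pow_two]; exact_mod_cast hd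
      simp [den, hc, this]
  have := key (h⁻¹ * g) (by
    rw [mul_smul]; change h⁻¹ • geodesic g 0 = _
    rw [H, geodesic, inv_smul_smul])
  rw [mul_smul, inv_smul_eq_iff] at this
  exact this

/-- The geodesic flow `exp(tV)` on `S*ℍ`. -/
def flow (t : ℝ) (ρ : Cosphere) : Cosphere := geodesic (exists_geodesic ρ).choose t

theorem flow_geodesic (g : SL(2, ℝ)) (t : ℝ) : flow t (geodesic g 0) = geodesic g t :=
  geodesic_congr (exists_geodesic (geodesic g 0)).choose_spec t

theorem flow_smul (g : SL(2, ℝ)) (t : ℝ) (ρ : Cosphere) : flow t (g • ρ) = g • flow t ρ := by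
  obtain ⟨h, rfl⟩ := exists_geodesic ρ
  rw [smul_geodesic, flow_geodesic, flow_geodesic, smul_geodesic]

/-! ### The quotient -/

/-- The cosphere bundle `S*M = Γ \ S*ℍ` of `M = Γ \ ℍ`. -/
abbrev QuotCosphere (Γ : Subgroup SL(2, ℝ)) : Type := MulAction.orbitRel.Quotient Γ Cosphere

instance (Γ : Subgroup SL(2, ℝ)) : MeasurableSpace (QuotCosphere Γ) := borel _

instance (Γ : Subgroup SL(2, ℝ)) : BorelSpace (QuotCosphere Γ) := ⟨rfl⟩

/-- The projection `S*ℍ → S*M`. -/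
def proj (Γ : Subgroup SL(2, ℝ)) (ρ : Cosphere) : QuotCosphere Γ := Quotient.mk'' ρ

/-- The geodesic flow `exp(tV)` on `S*M`. -/
def quotFlow (Γ : Subgroup SL(2, ℝ)) (t : ℝ) : QuotCosphere Γ → QuotCosphere Γ :=
  Quotient.map' (flow t) (by
    rintro _ σ ⟨γ, rfl⟩
    exact ⟨γ, (flow_smul (γ : SL(2, ℝ)) t σ).symm⟩)

/-- `M = Γ \ ℍ` has finite area: some measurable subset of `ℍ` of finite hyperbolic area
meets every orbit (`volume` on `ℍ` is `dx dy / y²`). -/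
def HasFiniteArea (Γ : Subgroup SL(2, ℝ)) : Prop :=
  ∃ F : Set ℍ, MeasurableSet F ∧ (∀ z : ℍ, ∃ γ ∈ Γ, γ • z ∈ F) ∧ volume F < ⊤

/-- A measure `μ'` on `S*ℍ` is the lift of a measure `μ` on `S*M` if the projection preserves the
measure of every measurable set on which it is injective. -/
def IsLift (Γ : Subgroup SL(2, ℝ)) (μ : Measure (QuotCosphere Γ)) (μ' : Measure Cosphere) : Prop :=
  ∀ A : Set Cosphere, MeasurableSet A → InjOn (proj Γ) A → μ' A = μ (proj Γ '' A)

/-! ### The cusp at infinity and the measure attached to it -/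

/-- The point `(θ + i eʳ) / (2π)`. -/
def cuspPoint (r θ : ℝ) : ℍ :=
  ⟨⟨θ / (2 * Real.pi), Real.exp r / (2 * Real.pi)⟩, by positivity⟩

/-- `(r, θ) ↦ π_Γ((θ + i eʳ) / (2π))` is a coordinate system on `(R, ∞) × ℝ/2πℤ`. -/
def IsCuspRegion (Γ : Subgroup SL(2, ℝ)) (R : ℝ) : Prop :=
  InjOn (fun p : ℝ × ℝ => (Quotient.mk'' (cuspPoint p.1 p.2) : MulAction.orbitRel.Quotient Γ ℍ))
    (Ioi R ×ˢ Ico 0 (2 * Real.pi))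

/-- The covector `p_r = -1, p_θ = 0`, that is `-dr`, at `cuspPoint r θ`. As `r = log (2π y)`, it is
`-dy / y`. -/
def cuspCovector (r θ : ℝ) : Cosphere :=
  ⟨(cuspPoint r θ, -Complex.I / (cuspPoint r θ).im), by
    have := (cuspPoint r θ).im_pos
    simp [abs_of_pos this, this.ne']⟩

/-- `μ` is the Radon measure on `S*M` with
`∫ a dμ = lim_{t → ∞} e^{-2νt} ∫_{(R, ∞) × 𝕊¹} e^{2νr} (a ∘ exp(tV))(r, θ, -1, 0) dr dθ`
for all continuous compactly supported `a`. -/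
structure IsCuspMeasure (Γ : Subgroup SL(2, ℝ)) (R ν : ℝ) (μ : Measure (QuotCosphere Γ)) :
    Prop where
  regular : μ.Regular
  tendsto : ∀ a : QuotCosphere Γ → ℝ, Continuous a → HasCompactSupport a →
    Tendsto (fun t : ℝ => Real.exp (-2 * ν * t) *
      ∫ p in Ioi R ×ˢ Ico 0 (2 * Real.pi),
        Real.exp (2 * ν * p.1) * a (quotFlow Γ t (proj Γ (cuspCovector p.1 p.2))))
      atTop (𝓝 (∫ x, a x ∂μ))

/-! ### The boundary circle and boundary-pair coordinates -/

/-- `SL(2, ℝ)` acts on `∂ℍ = ℝ ∪ {∞}` by Möbius transformations. -/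
instance : MulAction SL(2, ℝ) (OnePoint ℝ) :=
  MulAction.compHom _ (Matrix.SpecialLinearGroup.toGL (n := Fin 2) (R := ℝ))

instance : MeasurableSpace (OnePoint ℝ) := borel _

instance : BorelSpace (OnePoint ℝ) := ⟨rfl⟩

/-- `(∂ℍ × ∂ℍ)` minus the diagonal. -/
abbrev BoundaryPair : Type := {q : OnePoint ℝ × OnePoint ℝ // q.1 ≠ q.2}

theorem smul_zero_eq (g : SL(2, ℝ)) : g • ((0 : ℝ) : OnePoint ℝ) =
    if g 1 1 = 0 then ∞ else ((g 0 1 / g 1 1 : ℝ) : OnePoint ℝ) := by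
  change (Matrix.SpecialLinearGroup.toGL g) • ((0 : ℝ) : OnePoint ℝ) = _
  rw [OnePoint.smul_some_eq_ite, mul_zero, mul_zero, zero_add, zero_add]
  rfl

theorem smul_infty_eq (g : SL(2, ℝ)) : g • (∞ : OnePoint ℝ) =
    if g 1 0 = 0 then ∞ else ((g 0 0 / g 1 0 : ℝ) : OnePoint ℝ) := by
  change (Matrix.SpecialLinearGroup.toGL g) • (∞ : OnePoint ℝ) = _
  rw [OnePoint.smul_infty_eq_ite]
  rfl

theorem exists_unit_vector (q : OnePoint ℝ) : ∃ p r : ℝ,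
    (q = if r = 0 then ∞ else ((p / r : ℝ) : OnePoint ℝ)) ∧ p ^ 2 + r ^ 2 = 1 := by
  induction q using OnePoint.rec with
  | infty => exact ⟨1, 0, by simp, by simp⟩
  | coe x =>
    have h : 0 < √(x ^ 2 + 1) := Real.sqrt_pos.2 (by positivity)
    refine ⟨x / √(x ^ 2 + 1), 1 / √(x ^ 2 + 1), ?_, ?_⟩
    · rw [if_neg (by positivity)]; congr 1; field_simp
    · rw [div_pow, div_pow, Real.sq_sqrt (by positivity)]; field_simp

theorem cosh_dist_geodesic (g : SL(2, ℝ)) (t : ℝ) :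
    Real.cosh (dist UpperHalfPlane.I (geodesic g t).pt) =
      ((g 0 0 ^ 2 + g 1 0 ^ 2) * Real.exp t + (g 0 1 ^ 2 + g 1 1 ^ 2) * Real.exp (-t)) / 2 := by
  set v := (verticalGeodesic t).pt with hv
  have e : (v : ℂ) = ⟨0, Real.exp t⟩ := rfl
  have ei : v.im = Real.exp t := rfl
  have hz : (geodesic g t).pt = g • v := rfl
  have hd : ‖den g v‖ ^ 2 = (g 1 0 * Real.exp t) ^ 2 + g 1 1 ^ 2 := by
    rw [← Complex.normSq_eq_norm_sq, Complex.normSq_apply, den, e]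
    simp; ring
  have hd0 : ‖den g v‖ ^ 2 ≠ 0 := pow_ne_zero _ (norm_ne_zero_iff.2 (den_ne_zero _ _))
  have hnum : (g • v).re ^ 2 + (g • v).im ^ 2 =
      ((g 0 0 * Real.exp t) ^ 2 + g 0 1 ^ 2) / ‖den g v‖ ^ 2 := by
    have h1 : (g • v).re ^ 2 + (g • v).im ^ 2 = ‖((g • v : ℍ) : ℂ)‖ ^ 2 := by
      rw [← Complex.normSq_eq_norm_sq, Complex.normSq_apply]; simp; ring
    rw [h1, coe_smul_eq, norm_div, div_pow, e, ← Complex.normSq_eq_norm_sq (_ + _),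
      Complex.normSq_apply]
    congr 1
    simp; ring
  rw [hz, UpperHalfPlane.cosh_dist', UpperHalfPlane.I_re, UpperHalfPlane.I_im]
  have h2 : (0 - (g • v).re) ^ 2 + 1 ^ 2 + (g • v).im ^ 2 =
      ((g • v).re ^ 2 + (g • v).im ^ 2) + 1 := by ring
  have hx := Real.exp_pos t
  rw [h2, hnum, im_smul_eq, ei, Real.exp_neg]
  rw [hd] at hd0 ⊢
  generalize hE : (g 1 0 * Real.exp t) ^ 2 + g 1 1 ^ 2 = E at hd0 ⊢
  field_simp
  rw [← hE]
  ring

/-- For `q₁ ≠ q₂` there is a geodesic from `q₁` to `q₂` whose point at time `0` is its point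
closest to `i`. -/
theorem exists_geodesic_closest (q : BoundaryPair) : ∃ g : SL(2, ℝ),
    g • ((0 : ℝ) : OnePoint ℝ) = q.1.1 ∧ g • (∞ : OnePoint ℝ) = q.1.2 ∧
    ∀ t, dist UpperHalfPlane.I (geodesic g 0).pt ≤ dist UpperHalfPlane.I (geodesic g t).pt := by
  obtain ⟨⟨q₁, q₂⟩, hq⟩ := q
  obtain ⟨p, r, hpr, hN2⟩ : ∃ p r : ℝ, (q₂ = if r = 0 then ∞ else ((p / r : ℝ) : OnePoint ℝ)) ∧
      p ^ 2 + r ^ 2 = 1 := exists_unit_vector q₂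
  obtain ⟨p', r', hpr', hN1⟩ : ∃ p r : ℝ, (q₁ = if r = 0 then ∞ else ((p / r : ℝ) : OnePoint ℝ)) ∧
      p ^ 2 + r ^ 2 = 1 := exists_unit_vector q₁
  have hD : p * r' - p' * r ≠ 0 := by
    intro hD
    apply hq
    change q₁ = q₂
    rw [hpr, hpr']
    by_cases h : r = 0
    · have hp : p ≠ 0 := by rintro rfl; simp [h] at hN2
      have : r' = 0 := by
        rw [h, mul_zero, sub_zero] at hD; exact (mul_eq_zero.1 hD).resolve_left hp
      simp [h, this]
    · have h' : r' ≠ 0 := by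
        intro h'
        have hp : p' ≠ 0 := by rintro rfl; simp [h'] at hN1
        rw [h', mul_zero, zero_sub, neg_eq_zero] at hD
        exact (mul_ne_zero hp h) hD
      rw [if_neg h, if_neg h']
      congr 1
      rw [div_eq_div_iff h' h]; linarith
  set D := p * r' - p' * r with hDdef
  have hs : (√|D|) ^ 2 = |D| := Real.sq_sqrt (abs_nonneg _)
  have hs0 : √|D| ≠ 0 := (Real.sqrt_pos.2 (abs_pos.2 hD)).ne'
  set β := (√|D|)⁻¹ with hβ
  have hβ0 : β ≠ 0 := inv_ne_zero hs0
  have hβ2 : β ^ 2 * |D| = 1 := by rw [hβ, inv_pow, hs]; exact inv_mul_cancel₀ (abs_pos.2 hD).ne'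
  obtain ⟨α, hα0, hα2, hαβ⟩ : ∃ α : ℝ, α ≠ 0 ∧ α ^ 2 = β ^ 2 ∧ α * β * D = 1 := by
    rcases lt_or_gt_of_ne hD with h | h
    · exact ⟨-β, neg_ne_zero.2 hβ0, by ring, by rw [abs_of_neg h] at hβ2; linarith⟩
    · exact ⟨β, hβ0, rfl, by rw [abs_of_pos h] at hβ2; linarith⟩
  let g : SL(2, ℝ) := ⟨!![α * p, β * p'; α * r, β * r'], by
    rw [Matrix.det_fin_two_of]
    have : α * p * (β * r') - β * p' * (α * r) = α * β * D := by rw [hDdef]; ring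
    rw [this, hαβ]⟩
  refine ⟨g, ?_, ?_, ?_⟩
  · change _ = q₁
    rw [smul_zero_eq, hpr']
    simp [g, hβ0, mul_div_mul_left]
  · change _ = q₂
    rw [smul_infty_eq, hpr]
    simp [g, hα0, mul_div_mul_left]
  · intro t
    have h00 : g 0 0 = α * p := rfl
    have h10 : g 1 0 = α * r := rfl
    have h01 : g 0 1 = β * p' := rfl
    have h11 : g 1 1 = β * r' := rfl
    have e1 : g 0 0 ^ 2 + g 1 0 ^ 2 = β ^ 2 := by rw [h00, h10, ← hα2]; linear_combination α ^ 2 * hN2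
    have e2 : g 0 1 ^ 2 + g 1 1 ^ 2 = β ^ 2 := by rw [h01, h11]; linear_combination β ^ 2 * hN1
    have hc := Real.one_le_cosh t
    rw [Real.cosh_eq] at hc
    rw [← abs_of_nonneg (dist_nonneg (x := UpperHalfPlane.I) (y := (geodesic g 0).pt)),
      ← abs_of_nonneg (dist_nonneg (x := UpperHalfPlane.I) (y := (geodesic g t).pt)),
      ← Real.cosh_le_cosh, cosh_dist_geodesic, cosh_dist_geodesic, e1, e2, neg_zero, Real.exp_zero]
    nlinarith [sq_nonneg β]

/-- The parametrization `𝒯(q₁, q₂, t)` of `S*ℍ`: the point and unit covector at time `t` of the unit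
speed geodesic from `q₁` to `q₂` that is closest to `i` at time `0`. -/
def boundaryParam (x : BoundaryPair × ℝ) : Cosphere :=
  geodesic (exists_geodesic_closest x.1).choose x.2

/-! ### The measures on the boundary -/

/-- The translation `z ↦ z + 1`. -/
def translation : SL(2, ℝ) := ⟨!![1, 1; 0, 1], by simp⟩

/-- The group `Γ_∞` of the elements of `Γ` that fix `∞`. -/
def cuspStabilizer (Γ : Subgroup SL(2, ℝ)) : Subgroup SL(2, ℝ) :=
  Γ ⊓ MulAction.stabilizer SL(2, ℝ) (∞ : OnePoint ℝ)

/-- The set of cosets `γ Γ_∞`. -/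
abbrev CuspCosets (Γ : Subgroup SL(2, ℝ)) : Type := Γ ⧸ (cuspStabilizer Γ).subgroupOf Γ

/-- A matrix `(a b; c d)` representing the coset. -/
def rep {Γ : Subgroup SL(2, ℝ)} (x : CuspCosets Γ) : SL(2, ℝ) := (x.out : Γ)

/-- The measure `∑ δ_{a/c} / (a² + c²)^{2ν+1}` over the cosets `γ Γ_∞`, with `a/c = γ ∞`. -/
def muHat (Γ : Subgroup SL(2, ℝ)) (ν : ℝ) : Measure (OnePoint ℝ) :=
  Measure.sum fun x : CuspCosets Γ =>
    ENNReal.ofReal (1 / ((rep x 0 0) ^ 2 + (rep x 1 0) ^ 2) ^ (2 * ν + 1)) •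
      Measure.dirac (rep x • (∞ : OnePoint ℝ))

/-- Lebesgue measure `dq` on `∂ℍ = ℝ ∪ {∞}`; the point `∞` has measure zero. -/
def dq : Measure (OnePoint ℝ) := Measure.map ((↑) : ℝ → OnePoint ℝ) volume

/-- The density `|q₁ - q₂|^{-2(ν+1)} |q₁ + i|^{2(ν+1)} |q₂ + i|^{2ν}`, extended to `q₁ = ∞` by
continuity. Its value at `q₂ = ∞`, a null set of `dq₂`, is irrelevant. -/
def density (ν : ℝ) : OnePoint ℝ → OnePoint ℝ → ℝ
  | some q₁, some q₂ => |q₁ - q₂| ^ (-2 * (ν + 1)) * ‖(q₁ : ℂ) + Complex.I‖ ^ (2 * (ν + 1)) *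
      ‖(q₂ : ℂ) + Complex.I‖ ^ (2 * ν)
  | none, some q₂ => ‖(q₂ : ℂ) + Complex.I‖ ^ (2 * ν)
  | _, none => 0

/-- The measure `density · (muHat × dq₂)` on the pairs of distinct boundary points. -/
def muTilde (Γ : Subgroup SL(2, ℝ)) (ν : ℝ) : Measure BoundaryPair :=
  (((muHat Γ ν).prod dq).comap Subtype.val).withDensity
    fun q => ENNReal.ofReal (density ν q.1.1 q.1.2)

/-- The measure `e^{-2νt} dt`. -/
def expMeasure (ν : ℝ) : Measure ℝ :=
  volume.withDensity fun t => ENNReal.ofReal (Real.exp (-2 * ν * t))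

/-! ### Derivatives on the boundary of the ball model -/

/-- The matrix of `z ↦ (z - i) / (z + i)`, which maps `ℍ` to the ball model. -/
def cayley : Matrix (Fin 2) (Fin 2) ℂ := !![1, -Complex.I; 1, Complex.I]

/-- The transformation `γ` in the ball model, `w ↦ C γ C⁻¹ w`. -/
def ballMap (γ : SL(2, ℝ)) (w : ℂ) : ℂ :=
  let m : Matrix (Fin 2) (Fin 2) ℂ :=
    cayley * (γ : Matrix (Fin 2) (Fin 2) ℝ).map ((↑) : ℝ → ℂ) * cayley⁻¹
  (m 0 0 * w + m 0 1) / (m 1 0 * w + m 1 1)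

/-- The point of the unit circle that corresponds to `q ∈ ℝ ∪ {∞}`. -/
def ballPoint : OnePoint ℝ → ℂ
  | some q => ((q : ℂ) - Complex.I) / ((q : ℂ) + Complex.I)
  | none => 1

/-- `|γ'_𝔹(q)|`, the absolute value of the derivative of `γ` at `q` in the ball model. -/
def ballDeriv (γ : SL(2, ℝ)) (q : OnePoint ℝ) : ℝ := ‖deriv (ballMap γ) (ballPoint q)‖

end

end CuspLift

open CuspLift

namespace CuspLift

/-! ### Topology of the cosphere bundle -/

namespace Cosphere

/-! The covectors `-dr` over the cusp lie on the vertical geodesics coming down from `∞`, along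
which `r` is an arc length parameter. The flow therefore only replaces `r` by `r - t`
(`flow_cuspCovector`). Substituting `r + t` for `r` cancels the factor `e^{-2νt}` and moves the
domain from `r > R` to `r > R - t`. The limit is the integral over the whole strip, so the measure
is `cuspMeasure`, the image in `S*M` of `e^{2νr} dr dθ`. It is finite on compact sets, because a
compact set stays below some height in the cusp and `e^{2νr}` is integrable at `-∞`. Uniqueness is
that of a regular measure with given integrals of test functions.

The lift is found by unfolding. Up to sign, every element of `Γ` is uniquely of the form `rep x *
translation ^ n`, and only `±1` fixes a covector. The preimage of the strip measure is thus the sum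
over the cosets `x` of the `rep x`-translates of `e^{2νr} dr dθ` on the whole plane
(`isLift_liftMeasure`). No other lift exists, since sets on which the projection is injective
determine a measure.

For boundary coordinates, let `g = rep x` have first column `(a, c)`. The translate by `g` of the
geodesic from `∞` down to `x` runs from `g ∞ = a/c` to `y = g x`. Three factors arise: the Jacobian
`dy = dx / (cx + d)²`, the shift of time that puts the origin at the point closest to `i`, and the
weight `(a² + c²)^{-(2ν+1)}`. Multiplied by the density they give `1`
(`lintegral_boundaryParam_fiber`). The power of `2π` comes from the scaling of `r` and `θ`.

Finiteness of `muHat` is a packing argument. Injectivity of the cusp coordinates bounds nonzero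
lower left entries of `Γ` away from `0`, so the columns `(a, c)` have pairwise determinants bounded
below, and such families are sparse (`tsum_inv_norm_rpow_lt_top`). Equivariance holds atom by atom,
because the derivative in the ball model at `a/c` is the ratio of the squared lengths of `(a, c)`
and its image. -/

theorem isClosedEmbedding_val : IsClosedEmbedding (Subtype.val : Cosphere → ℍ × ℂ) := by
  have h : IsClosed {p : ℍ × ℂ | p.1.im * ‖p.2‖ = 1} :=
    isClosed_eq ((UpperHalfPlane.continuous_im.comp continuous_fst).mul continuous_snd.norm)
      continuous_const
  exact h.isClosedEmbedding_subtypeVal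

theorem continuous_pt : Continuous pt :=
  continuous_fst.comp isClosedEmbedding_val.continuous

theorem continuous_cov : Continuous cov :=
  continuous_snd.comp isClosedEmbedding_val.continuous

instance : T2Space Cosphere := isClosedEmbedding_val.isEmbedding.t2Space

instance : SecondCountableTopology Cosphere :=
  isClosedEmbedding_val.isEmbedding.secondCountableTopology

instance : LocallyCompactSpace Cosphere := isClosedEmbedding_val.locallyCompactSpace

instance : PolishSpace Cosphere := by
  have : PolishSpace (range ((↑) : ℍ → ℂ)) :=
    UpperHalfPlane.isOpenEmbedding_coe.isOpen_range.polishSpace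
  have : PolishSpace ℍ :=
    UpperHalfPlane.isEmbedding_coe.toHomeomorph.isClosedEmbedding.polishSpace
  exact isClosedEmbedding_val.polishSpace

theorem isEmbedding_coe_pt_cov : IsEmbedding fun ρ : Cosphere => ((ρ.pt : ℂ), ρ.cov) :=
  (UpperHalfPlane.isEmbedding_coe.prodMap .id).comp isClosedEmbedding_val.isEmbedding

theorem measurable_of_coe {α : Type*} [MeasurableSpace α] {f : α → Cosphere}
    (h₁ : Measurable fun x => ((f x).pt : ℂ)) (h₂ : Measurable fun x => (f x).cov) :
    Measurable f := by
  have h : (instMeasurableSpace : MeasurableSpace Cosphere) =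
      MeasurableSpace.comap (fun ρ : Cosphere => ((ρ.pt : ℂ), ρ.cov)) inferInstance := by
    rw [BorelSpace.measurable_eq (α := Cosphere), BorelSpace.measurable_eq (α := ℂ × ℂ),
      isEmbedding_coe_pt_cov.eq_induced, borel_comap]
  rw [h]
  exact measurable_comap_iff.2 (h₁.prodMk h₂)

theorem continuous_of_coe {α : Type*} [TopologicalSpace α] {f : α → Cosphere}
    (h₁ : Continuous fun x => ((f x).pt : ℂ)) (h₂ : Continuous fun x => (f x).cov) :
    Continuous f :=
  isEmbedding_coe_pt_cov.continuous_iff.2 (h₁.prodMk h₂)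

end Cosphere

theorem continuous_den (g : SL(2, ℝ)) : Continuous (den g) := by
  have := UpperHalfPlane.continuous_coe
  unfold den; fun_prop

instance : ContinuousConstSMul SL(2, ℝ) Cosphere where
  continuous_const_smul g := by
    have h := (continuous_den g).comp Cosphere.continuous_pt
    refine Cosphere.continuous_of_coe ?_ ?_
    · exact UpperHalfPlane.continuous_coe.comp
        ((continuous_const_smul g).comp Cosphere.continuous_pt)
    · exact Cosphere.continuous_cov.mul ((Complex.continuous_conj.comp h).pow 2)

/-- A fixed covector has `(cz + d)² = 1`. Consequently `PSL(2, ℝ)` acts freely on `S*ℍ`, even where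
conic points obstruct freeness on `ℍ`. -/
theorem smul_eq_self_iff (g : SL(2, ℝ)) (ρ : Cosphere) : g • ρ = ρ ↔ g = 1 ∨ g = -1 := by
  constructor
  · intro h
    have hp : g • ρ.pt = ρ.pt := by rw [← smul_pt, h]
    have hc : ρ.cov * (starRingEnd ℂ (den g ρ.pt)) ^ 2 = ρ.cov := by rw [← smul_cov, h]
    have hρ : ρ.pt.im * ‖ρ.cov‖ = 1 := ρ.2
    have hc0 : ρ.cov ≠ 0 := by rintro h0; simp [h0] at hρ
    rw [mul_eq_left₀ hc0, ← map_pow, map_eq_one_iff _ (starRingEnd ℂ).injective, sq_eq_one_iff]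
      at hc
    have hz := ρ.pt.im_pos
    set z := ρ.pt
    have e := congrArg UpperHalfPlane.coe hp
    rw [coe_smul_eq, div_eq_iff (den_ne_zero _ _)] at e
    have key : ∀ ε : ℝ, den g z = ε → g 1 0 = 0 ∧ g 1 1 = ε ∧ g 0 0 = ε ∧ g 0 1 = 0 := by
      intro ε hε
      rw [hε] at e
      have i1 := congrArg Complex.im hε
      have r1 := congrArg Complex.re hε
      have i2 := congrArg Complex.im e
      have r2 := congrArg Complex.re e
      simp [den] at i1 r1 i2 r2
      have c0 : g 1 0 = 0 := i1.resolve_right hz.ne'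
      have a0 : g 0 0 = ε := by
        have : (g 0 0 - ε) * z.im = 0 := by linarith
        exact sub_eq_zero.1 ((mul_eq_zero.1 this).resolve_right hz.ne')
      refine ⟨c0, by simpa [c0] using r1, a0, ?_⟩
      rw [a0] at r2; linarith
    rcases hc with hc | hc
    · left
      obtain ⟨h1, h2, h3, h4⟩ := key 1 (by simpa using hc)
      ext i j; fin_cases i <;> fin_cases j <;> simp [h1, h2, h3, h4]
    · right
      obtain ⟨h1, h2, h3, h4⟩ := key (-1) (by simpa using hc)
      ext i j; fin_cases i <;> fin_cases j <;> simp [h1, h2, h3, h4]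
  · rintro (rfl | rfl)
    · exact one_smul _ _
    · refine Cosphere.ext' ?_ ?_
      · rw [smul_pt, UpperHalfPlane.ext_iff, coe_smul_eq]
        simp [den]
      · rw [smul_cov]; simp [den]

theorem neg_one_smul_cosphere (ρ : Cosphere) : (-1 : SL(2, ℝ)) • ρ = ρ :=
  (smul_eq_self_iff _ _).2 (Or.inr rfl)

/-! ### The projection to the quotient by a discrete group -/

section Quotient

variable (Γ : Subgroup SL(2, ℝ))

theorem countable_of_discrete [DiscreteTopology Γ] : Countable Γ := by
  have : SecondCountableTopology (Matrix (Fin 2) (Fin 2) ℝ) :=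
    inferInstanceAs (SecondCountableTopology (Fin 2 → Fin 2 → ℝ))
  have : SecondCountableTopology SL(2, ℝ) :=
    Matrix.SpecialLinearGroup.isClosedEmbedding_val.isEmbedding.secondCountableTopology
  exact TopologicalSpace.separableSpace_iff_countable.1 inferInstance

instance : ContinuousConstSMul Γ Cosphere where
  continuous_const_smul γ := continuous_const_smul (γ : SL(2, ℝ))

/-- Inherited from `ℍ`: if a translate of `K` meets `L`, so do their sets of base points. -/
instance [DiscreteTopology Γ] : ProperlyDiscontinuousSMul Γ Cosphere where
  finite_disjoint_inter_image {K L} hK hL := by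
    refine (ProperlyDiscontinuousSMul.finite_disjoint_inter_image (Γ := Γ)
      (hK.image Cosphere.continuous_pt) (hL.image Cosphere.continuous_pt)).subset ?_
    rintro γ ⟨_, ⟨ρ, hρ, rfl⟩, h⟩
    exact ⟨_, ⟨_, ⟨ρ, hρ, rfl⟩, rfl⟩, ⟨_, h, rfl⟩⟩

theorem continuous_proj : Continuous (proj Γ) := continuous_quot_mk

theorem isOpenMap_proj : IsOpenMap (proj Γ) := isOpenMap_quotient_mk'_mul

theorem surjective_proj : Function.Surjective (proj Γ) := Quotient.mk''_surjective

theorem proj_eq_proj_iff {ρ σ : Cosphere} :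
    proj Γ ρ = proj Γ σ ↔ ∃ γ ∈ Γ, γ • σ = ρ := by
  rw [proj, proj, Quotient.eq'']
  exact ⟨fun ⟨γ, h⟩ => ⟨γ, γ.2, h⟩, fun ⟨γ, hγ, h⟩ => ⟨⟨γ, hγ⟩, h⟩⟩

instance : SecondCountableTopology (QuotCosphere Γ) :=
  ContinuousConstSMul.secondCountableTopology

instance : LocallyCompactSpace (QuotCosphere Γ) :=
  IsOpenQuotientMap.locallyCompactSpace
    ⟨surjective_proj Γ, continuous_proj Γ, isOpenMap_proj Γ⟩

/-- Every covector has a neighbourhood on which the projection is injective. -/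
theorem exists_open_injOn_proj [DiscreteTopology Γ] (ρ : Cosphere) :
    ∃ U : Set Cosphere, IsOpen U ∧ ρ ∈ U ∧ InjOn (proj Γ) U := by
  -- Any `γ` for which `γ U` meets `U` fixes `ρ`, hence is `±1` and fixes every covector.
  obtain ⟨U, hU, h⟩ := ProperlyDiscontinuousSMul.exists_nhds_image_smul_eq_self Γ ρ
  obtain ⟨V, hVU, hV, hρ⟩ := mem_nhds_iff.1 hU
  refine ⟨V, hV, hρ, fun σ hσ τ hτ hστ => ?_⟩
  obtain ⟨γ, hγ, rfl⟩ := (proj_eq_proj_iff Γ).1 hστ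
  have := h ⟨γ, hγ⟩ ⟨_, ⟨τ, hVU hτ, rfl⟩, hVU hσ⟩
  exact (smul_eq_self_iff _ _).2 ((smul_eq_self_iff γ ρ).1 this)

/-- A measure on `S*ℍ` is determined by its values on the sets on which the projection is
injective. -/
theorem ext_of_injOn_proj [DiscreteTopology Γ] {μ ν : Measure Cosphere}
    (h : ∀ A, MeasurableSet A → InjOn (proj Γ) A → μ A = ν A) : μ = ν := by
  choose U hU hρ hinj using exists_open_injOn_proj Γ
  obtain ⟨T, hT, hT'⟩ := TopologicalSpace.isOpen_iUnion_countable U hU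
  have hcov : ⋃ i ∈ T, U i = univ := by
    rw [hT']; exact iUnion_eq_univ_iff.2 fun ρ => ⟨ρ, hρ ρ⟩
  refine (Measure.ext_iff_of_biUnion_eq_univ hT hcov).2 fun i _ => ?_
  ext A hA
  rw [Measure.restrict_apply hA, Measure.restrict_apply hA]
  exact h _ (hA.inter (hU i).measurableSet) ((hinj i).mono inter_subset_right)

end Quotient

/-! ### Convergence of sums over separated vectors -/

/-- A packing argument. Above each `p/q ∈ [-1, 1]` sits a box of width and height comparable to
`1/q²`. Separation makes the boxes disjoint, the measure `y^{s-2} dx dy` gives each a mass at least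
a constant times `q^{-2s}`, and the bounded region containing them has finite mass because `s - 2 >
-1`. -/
theorem tsum_inv_sq_rpow_lt_top_of_abs_le {ι : Type*} [Countable ι] {p q : ι → ℝ} {c s : ℝ}
    (hc : 0 < c) (hs : 1 < s) (hsep : Pairwise fun i j => c ≤ |p i * q j - p j * q i|)
    (hq : ∀ i, q i ≠ 0) (hpq : ∀ i, |p i| ≤ |q i|) :
    ∑' i, ENNReal.ofReal (1 / (q i ^ 2) ^ s) < ⊤ := by
  rcases isEmpty_or_nonempty ι with h | ⟨⟨j⟩⟩
  · simp
  set h : ι → ℝ := fun i => 1 / q i ^ 2 with hh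
  have hpos : ∀ i, 0 < h i := fun i => by have := hq i; positivity
  obtain ⟨H, hH⟩ : ∃ H, ∀ i, h i ≤ H := by
    -- For `i ≠ j` separation from the fixed index `j` gives `c ≤ 2 |q i| |q j|`.
    refine ⟨max (h j) (4 * q j ^ 2 / c ^ 2), fun i => ?_⟩
    by_cases hij : i = j
    · rw [hij]; exact le_max_left _ _
    refine le_max_of_le_right ?_
    have h1 : c ≤ 2 * (|q i| * |q j|) := by
      calc c ≤ |p i * q j - p j * q i| := hsep hij
        _ ≤ |p i * q j| + |p j * q i| := abs_sub _ _
        _ = |p i| * |q j| + |p j| * |q i| := by rw [abs_mul, abs_mul]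
        _ ≤ |q i| * |q j| + |q j| * |q i| := 
          add_le_add (mul_le_mul_of_nonneg_right (hpq i) (abs_nonneg _))
            (mul_le_mul_of_nonneg_right (hpq j) (abs_nonneg _))
        _ = _ := by ring
    have h2 : c ^ 2 ≤ 4 * q j ^ 2 * q i ^ 2 := by
      calc c ^ 2 ≤ (2 * (|q i| * |q j|)) ^ 2 := by gcongr
        _ = 4 * |q j| ^ 2 * |q i| ^ 2 := by ring
        _ = _ := by rw [sq_abs, sq_abs]
    have := hq i
    rw [hh, div_le_div_iff₀ (by positivity) (by positivity)]
    linarith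
  -- Overlapping boxes have heights `h i`, `h j` within a factor `2` of each other, so `(h i + h j)²
  -- ≤ 9 h i h j`. The factor `1/3` then contradicts the lower bound `c² h i h j` for the squared
  -- distance of the centres.
  set κ := c / 3 with hκ
  have hκ0 : 0 < κ := by positivity
  let B : ι → Set (ℝ × ℝ) := fun i =>
    Ioo (p i / q i - κ * h i) (p i / q i + κ * h i) ×ˢ Ioc (h i / 2) (h i)
  have hBm : ∀ i, MeasurableSet (B i) := fun i => measurableSet_Ioo.prod measurableSet_Ioc
  have hdisj : Pairwise (Function.onFun Disjoint B) := by
    intro i j hij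
    rw [Function.onFun, Set.disjoint_left]
    rintro ⟨x, y⟩ ⟨⟨h1, h2⟩, h3, h4⟩ ⟨⟨h5, h6⟩, h7, h8⟩
    simp only at h1 h2 h3 h4 h5 h6 h7 h8
    have hi := hpos i
    have hj := hpos j
    have e : (p i / q i - p j / q j) ^ 2 = |p i * q j - p j * q i| ^ 2 * (h i * h j) := by
      have := hq i
      have := hq j
      rw [sq_abs, hh]; field_simp
    have l1 : c ^ 2 * (h i * h j) ≤ (p i / q i - p j / q j) ^ 2 := by
      rw [e]
      gcongr
      exact hsep hij
    have l2 : (p i / q i - p j / q j) ^ 2 < (κ * (h i + h j)) ^ 2 := by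
      rw [sq_lt_sq, abs_of_pos (a := κ * (h i + h j)) (by positivity), abs_lt]
      constructor <;> linarith
    have l3 : (h i + h j) ^ 2 ≤ 9 * (h i * h j) := by nlinarith
    have l4 : (κ * (h i + h j)) ^ 2 ≤ c ^ 2 * (h i * h j) := by
      rw [mul_pow, hκ]
      nlinarith [sq_nonneg c]
    linarith
  let w : ℝ × ℝ → ENNReal := fun z => ENNReal.ofReal (z.2 ^ (s - 2))
  have hsub : (⋃ i, B i) ⊆ Ioo (-(1 + κ * H)) (1 + κ * H) ×ˢ Ioc 0 H := by
    refine iUnion_subset fun i => ?_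
    rintro ⟨x, y⟩ ⟨⟨h1, h2⟩, h3, h4⟩
    simp only at h1 h2 h3 h4
    have hi := hpos i
    have h5 : |p i / q i| ≤ 1 := by
      rw [abs_div]; exact div_le_one_of_le₀ (hpq i) (abs_nonneg _)
    have h6 : κ * h i ≤ κ * H := by gcongr; exact hH i
    rw [abs_le] at h5
    exact ⟨⟨by linarith, by linarith⟩, by linarith, by linarith [hH i]⟩
  have hfin : ∫⁻ z in Ioo (-(1 + κ * H)) (1 + κ * H) ×ˢ Ioc 0 H, w z < ⊤ := by
    rw [Measure.volume_eq_prod, ← Measure.prod_restrict]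
    have : ∫⁻ z, w z ∂((volume.restrict (Ioo (-(1 + κ * H)) (1 + κ * H))).prod
        (volume.restrict (Ioc 0 H))) =
        ∫⁻ z : ℝ × ℝ, (fun _ => 1) z.1 * (fun y : ℝ => ENNReal.ofReal (y ^ (s - 2))) z.2
          ∂((volume.restrict (Ioo (-(1 + κ * H)) (1 + κ * H))).prod
        (volume.restrict (Ioc 0 H))) := by simp [w]
    rw [this, lintegral_prod_mul (f := fun _ => 1)
      (g := fun y : ℝ => ENNReal.ofReal (y ^ (s - 2))) aemeasurable_const (by fun_prop)]
    have hH0 : 0 ≤ H := (hpos j).le.trans (hH j)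
    have hint : IntegrableOn (fun y : ℝ => y ^ (s - 2)) (Ioc 0 H) :=
      (intervalIntegrable_iff_integrableOn_Ioc_of_le hH0).1
        (intervalIntegral.intervalIntegrable_rpow' (by linarith))
    refine ENNReal.mul_lt_top (by simp) ?_
    exact (hasFiniteIntegral_iff_ofReal ((ae_restrict_iff' measurableSet_Ioc).2
      (ae_of_all _ fun y hy => Real.rpow_nonneg hy.1.le _))).1 hint.2
  -- Writing `y^{s-2} = y^{s-1} y⁻¹` bounds the weight below by `(h/2)^{s-1} h⁻¹`, whatever the sign
  -- of `s - 2`; the box has area `κ h²`.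
  have hlow : ∀ i, ENNReal.ofReal (κ * 2 ^ (1 - s)) * ENNReal.ofReal (1 / (q i ^ 2) ^ s) ≤
      ∫⁻ z in B i, w z := by
    intro i
    have hi := hpos i
    have h1 : ∀ z ∈ B i, ENNReal.ofReal ((h i / 2) ^ (s - 1) * (h i)⁻¹) ≤ w z := by
      rintro ⟨x, y⟩ ⟨-, h3, h4⟩
      simp only at h3 h4
      have hy : 0 < y := by linarith
      refine ENNReal.ofReal_le_ofReal ?_
      have : s - 2 = (s - 1) + (-1) := by ring
      simp only
      rw [this, Real.rpow_add hy, Real.rpow_neg_one]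
      gcongr
    calc _ = ENNReal.ofReal ((h i / 2) ^ (s - 1) * (h i)⁻¹) * volume (B i) := by
          rw [Measure.volume_eq_prod, Measure.prod_prod, Real.volume_Ioo, Real.volume_Ioc,
            ← ENNReal.ofReal_mul (by positivity), ← ENNReal.ofReal_mul (by linarith [mul_pos hκ0 hi]),
            ← ENNReal.ofReal_mul (by positivity)]
          apply congrArg
          have e1 : 1 / (q i ^ 2) ^ s = h i ^ s := by
            rw [hh]; simp only; rw [Real.div_rpow zero_le_one (sq_nonneg _), Real.one_rpow]
          have e2 : h i ^ s = h i ^ (s - 1) * h i := by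
            rw [← Real.rpow_add_one hi.ne', sub_add_cancel]
          have e3 : (2 : ℝ) ^ (1 - s) = (2 ^ (s - 1))⁻¹ := by
            rw [← Real.rpow_neg (by norm_num)]; ring_nf
          rw [e1, e2, e3, Real.div_rpow hi.le (by norm_num)]
          field_simp
          ring
      _ = ∫⁻ _ in B i, ENNReal.ofReal ((h i / 2) ^ (s - 1) * (h i)⁻¹) := by
          rw [setLIntegral_const]
      _ ≤ _ := setLIntegral_mono' (hBm i) h1
  have htot : ENNReal.ofReal (κ * 2 ^ (1 - s)) * ∑' i, ENNReal.ofReal (1 / (q i ^ 2) ^ s) < ⊤ := by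
    rw [← ENNReal.tsum_mul_left]
    calc _ ≤ ∑' i, ∫⁻ z in B i, w z := ENNReal.tsum_le_tsum hlow
      _ = ∫⁻ z in ⋃ i, B i, w z := (lintegral_iUnion hBm hdisj _).symm
      _ ≤ _ := lintegral_mono_set hsub
      _ < ⊤ := hfin
  have hk : ENNReal.ofReal (κ * 2 ^ (1 - s)) ≠ 0 := by
    rw [Ne, ENNReal.ofReal_eq_zero, not_le]; positivity
  exact (ENNReal.mul_lt_top_iff.1 htot).elim And.right fun h => by
    rcases h with h | h
    · exact absurd h hk
    · rw [h]; exact ENNReal.zero_lt_top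

/-- Vectors `(p, q)` with pairwise determinants bounded below are so sparse that
`∑ |(p, q)|^{-2s}` converges for `s > 1`. -/
theorem tsum_inv_norm_rpow_lt_top {ι : Type*} [Countable ι] {p q : ι → ℝ} {c s : ℝ}
    (hc : 0 < c) (hs : 1 < s) (hsep : Pairwise fun i j => c ≤ |p i * q j - p j * q i|)
    (h0 : ∀ i, p i ≠ 0 ∨ q i ≠ 0) :
    ∑' i, ENNReal.ofReal (1 / (p i ^ 2 + q i ^ 2) ^ s) < ⊤ := by
  -- The determinant condition is symmetric in `p` and `q`, so half of the indices are handled after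
  -- exchanging the coordinates.
  have key : ∀ (p q : ι → ℝ), (Pairwise fun i j => c ≤ |p i * q j - p j * q i|) →
      (∀ i, p i ≠ 0 ∨ q i ≠ 0) →
      ∑' i : {i | |p i| ≤ |q i|}, ENNReal.ofReal (1 / (p i ^ 2 + q i ^ 2) ^ s) < ⊤ := by
    intro p q hsep h0
    have hq : ∀ i : {i | |p i| ≤ |q i|}, q i ≠ 0 := by
      rintro ⟨i, hi⟩ hq
      have hi : |p i| ≤ |q i| := hi
      have hq : q i = 0 := hq
      rw [hq, abs_zero, abs_nonpos_iff] at hi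
      exact (h0 i).elim (fun h => h hi) fun h => h hq
    refine lt_of_le_of_lt (ENNReal.tsum_le_tsum fun i => ENNReal.ofReal_le_ofReal ?_)
      (tsum_inv_sq_rpow_lt_top_of_abs_le (ι := {i | |p i| ≤ |q i|}) (p := fun i => p i)
        (q := fun i => q i) hc hs (fun i j hij => hsep (Subtype.coe_injective.ne hij)) hq
        fun i => i.2)
    have := hq i
    gcongr
    linarith [sq_nonneg (p i)]
  have hcov : ({i | |p i| ≤ |q i|} : Set ι) ∪ {i | |q i| ≤ |p i|} = univ :=
    eq_univ_of_forall fun i => le_total |p i| |q i|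
  rw [← tsum_univ, ← hcov]
  refine lt_of_le_of_lt (ENNReal.tsum_union_le
    (fun i => ENNReal.ofReal (1 / (p i ^ 2 + q i ^ 2) ^ s)) _ _)
    (ENNReal.add_lt_top.2 ⟨key p q hsep h0, ?_⟩)
  have := key q p (fun i j hij => by
    change c ≤ _
    rw [abs_sub_comm, mul_comm (q i), mul_comm (q j), abs_sub_comm]
    simpa [abs_sub_comm, mul_comm] using hsep hij)
    fun i => (h0 i).symm
  simpa only [add_comm] using this

/-! ### Cosets of the cusp stabilizer -/

theorem det_eq_one (g : SL(2, ℝ)) : g 0 0 * g 1 1 - g 0 1 * g 1 0 = 1 := by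
  rw [← Matrix.det_fin_two, g.det_coe]

theorem translation_zpow_apply (n : ℤ) : (translation ^ n) 0 0 = 1 ∧ (translation ^ n) 0 1 = n ∧
    (translation ^ n) 1 0 = 0 ∧ (translation ^ n) 1 1 = 1 := by
  have h1 : translation 0 0 = 1 := rfl
  have h2 : translation 0 1 = 1 := rfl
  have h3 : translation 1 0 = 0 := rfl
  have h4 : translation 1 1 = 1 := rfl
  induction n using Int.induction_on with
  | zero => simp
  | succ n ih =>
    obtain ⟨i1, i2, i3, i4⟩ := ih
    rw [zpow_add_one]
    simp only [Matrix.SpecialLinearGroup.coe_mul, Matrix.mul_apply, Fin.sum_univ_two, i1, i2, i3,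
      i4, h1, h2, h3, h4]
    push_cast
    refine ⟨?_, ?_, ?_, ?_⟩ <;> ring
  | pred n ih =>
    obtain ⟨i1, i2, i3, i4⟩ := ih
    rw [zpow_sub_one, Matrix.SpecialLinearGroup.coe_mul, Matrix.SpecialLinearGroup.coe_inv,
      Matrix.adjugate_fin_two]
    simp only [Matrix.mul_apply, Fin.sum_univ_two, i1, i2, i3, i4, h1, h2, h3, h4,
      Matrix.of_apply, Matrix.cons_val_zero, Matrix.cons_val_one, Matrix.cons_val', Matrix.cons_val_fin_one]
    push_cast
    refine ⟨?_, ?_, ?_, ?_⟩ <;> ring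

theorem mem_closure_translation_iff {g : SL(2, ℝ)} :
    g ∈ Subgroup.closure {translation, -1} ↔
      ∃ n : ℤ, g = translation ^ n ∨ g = -translation ^ n := by
  constructor
  · intro h
    induction h using Subgroup.closure_induction with
    | mem x hx =>
      rcases hx with rfl | rfl
      · exact ⟨1, by simp⟩
      · exact ⟨0, by simp⟩
    | one => exact ⟨0, by simp⟩
    | mul x y _ _ hx hy =>
      obtain ⟨n, rfl | rfl⟩ := hx <;> obtain ⟨m, rfl | rfl⟩ := hy <;>
        exact ⟨n + m, by simp [zpow_add]⟩
    | inv x _ hx =>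
      obtain ⟨n, rfl | rfl⟩ := hx
      · exact ⟨-n, by simp⟩
      · refine ⟨-n, Or.inr ?_⟩
        rw [inv_eq_iff_mul_eq_one, zpow_neg, neg_mul_neg, mul_inv_cancel]
  · have hT : translation ∈ Subgroup.closure {translation, -1} :=
      Subgroup.subset_closure (Or.inl rfl)
    have hn : (-1 : SL(2, ℝ)) ∈ Subgroup.closure {translation, -1} :=
      Subgroup.subset_closure (Or.inr rfl)
    rintro ⟨n, rfl | rfl⟩
    · exact zpow_mem hT n
    · simpa using mul_mem hn (zpow_mem hT n)

theorem smul_infty_eq_infty_iff (g : SL(2, ℝ)) : g • (∞ : OnePoint ℝ) = ∞ ↔ g 1 0 = 0 := by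
  rw [smul_infty_eq]
  split_ifs with h <;> simp [h]

section Cosets

variable {Γ : Subgroup SL(2, ℝ)}

theorem rep_mem (x : CuspCosets Γ) : rep x ∈ Γ := x.out.2

theorem mem_cuspStabilizer_iff {g : SL(2, ℝ)} : g ∈ cuspStabilizer Γ ↔ g ∈ Γ ∧ g 1 0 = 0 := by
  rw [cuspStabilizer, Subgroup.mem_inf, MulAction.mem_stabilizer_iff, smul_infty_eq_infty_iff]

theorem mk_eq_iff (γ : Γ) (x : CuspCosets Γ) :
    (γ : CuspCosets Γ) = x ↔ (γ : SL(2, ℝ))⁻¹ * rep x ∈ cuspStabilizer Γ := by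
  conv_lhs => rw [← Quotient.out_eq' x]
  exact QuotientGroup.eq

theorem injective_rep_smul_infty :
    Function.Injective fun x : CuspCosets Γ => rep x • (∞ : OnePoint ℝ) := by
  intro x y h
  rw [← (mk_eq_iff x.out y).2]
  · exact (Quotient.out_eq' x).symm
  · refine ⟨Γ.mul_mem (Γ.inv_mem (rep_mem x)) (rep_mem y), ?_⟩
    change (rep x)⁻¹ * rep y ∈ MulAction.stabilizer SL(2, ℝ) (∞ : OnePoint ℝ)
    rw [MulAction.mem_stabilizer_iff, mul_smul, inv_smul_eq_iff]
    exact h.symm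

theorem translation_zpow_mem
    (hcusp : cuspStabilizer Γ = Subgroup.closure {translation, -1}) (n : ℤ) :
    translation ^ n ∈ Γ := by
  have : translation ^ n ∈ cuspStabilizer Γ :=
    hcusp ▸ mem_closure_translation_iff.2 ⟨n, Or.inl rfl⟩
  exact this.1

theorem exists_eq_rep_mul
    (hcusp : cuspStabilizer Γ = Subgroup.closure {translation, -1}) (γ : Γ) : ∃ n : ℤ,
    (γ : SL(2, ℝ)) = rep (γ : CuspCosets Γ) * translation ^ n ∨
      (γ : SL(2, ℝ)) = -(rep (γ : CuspCosets Γ) * translation ^ n) := by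
  have h := (mk_eq_iff γ γ).1 rfl
  rw [← inv_mem_iff, mul_inv_rev, inv_inv] at h
  replace h := mem_closure_translation_iff.1 (SetLike.ext_iff.1 hcusp _ |>.1 h)
  obtain ⟨n, h | h⟩ := h
  · exact ⟨n, Or.inl (by rw [← h, mul_inv_cancel_left])⟩
  · exact ⟨n, Or.inr (by rw [← mul_neg, ← h, mul_inv_cancel_left])⟩

theorem mul_translation_zpow_column (g : SL(2, ℝ)) (n : ℤ) :
    (g * translation ^ n) 0 0 = g 0 0 ∧ (g * translation ^ n) 1 0 = g 1 0 := by
  obtain ⟨h1, h2, h3, h4⟩ := translation_zpow_apply n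
  simp [Matrix.mul_apply, Fin.sum_univ_two, h1, h3]

/-- Right multiplication by a translation leaves the first column unchanged, and `-1` only changes
its sign. -/
theorem column_sq_eq_rep (hcusp : cuspStabilizer Γ = Subgroup.closure {translation, -1})
    (γ : Γ) : (γ : SL(2, ℝ)) 0 0 ^ 2 + (γ : SL(2, ℝ)) 1 0 ^ 2 =
    rep (γ : CuspCosets Γ) 0 0 ^ 2 + rep (γ : CuspCosets Γ) 1 0 ^ 2 := by
  obtain ⟨n, h | h⟩ := exists_eq_rep_mul hcusp γ <;>
    obtain ⟨h1, h2⟩ := mul_translation_zpow_column (rep (γ : CuspCosets Γ)) n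
  · rw [h, h1, h2]
  · rw [h]
    simp only [Matrix.SpecialLinearGroup.coe_neg, Matrix.neg_apply, h1, h2, neg_sq]

/-- The imaginary part is invariant under `Γ` inside the cusp region. -/
theorem im_smul_eq_of_lt (hcusp : cuspStabilizer Γ = Subgroup.closure {translation, -1})
    {R : ℝ} (hR : IsCuspRegion Γ R) {γ : SL(2, ℝ)} (hγ : γ ∈ Γ) {z : ℍ}
    (hz : Real.exp R / (2 * Real.pi) < z.im)
    (hγz : Real.exp R / (2 * Real.pi) < (γ • z).im) : (γ • z).im = z.im := by
  have hpi := Real.pi_pos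
  -- A horizontal integer translation brings `w` into the fundamental strip without changing its
  -- height; injectivity of the coordinates is then applied to the translates of `z` and `γ z`.
  have key : ∀ w : ℍ, Real.exp R / (2 * Real.pi) < w.im → ∃ p ∈ Ioi R ×ˢ Ico 0 (2 * Real.pi),
      ∃ γ ∈ Γ, γ • w = cuspPoint p.1 p.2 ∧ (γ • w).im = w.im := by
    intro w hw
    obtain ⟨h1, h2, h3, h4⟩ := translation_zpow_apply (-⌊w.re⌋)
    have hd : den (translation ^ (-⌊w.re⌋)) w = 1 := by
      rw [den, h3, h4]; simp
    have him : (translation ^ (-⌊w.re⌋) • w).im = w.im := by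
      rw [im_smul_eq, hd]; simp
    refine ⟨(Real.log (2 * Real.pi * w.im), 2 * Real.pi * Int.fract w.re), ⟨?_, ?_, ?_⟩, _,
      translation_zpow_mem hcusp (-⌊w.re⌋), ?_, him⟩
    · rw [mem_Ioi, Real.lt_log_iff_exp_lt (by have := w.im_pos; positivity)]
      rwa [div_lt_iff₀' (by positivity)] at hw
    · have := Int.fract_nonneg w.re; positivity
    · have := Int.fract_lt_one w.re
      simp only
      nlinarith
    · apply UpperHalfPlane.ext
      rw [coe_smul_eq, hd, h1, h2]
      have := w.im_pos
      apply Complex.ext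
      · have hf : Int.fract w.re = w.re - ⌊w.re⌋ := rfl
        simp only [cuspPoint]
        rw [mul_div_cancel_left₀ _ (by positivity)]
        simp
        linarith
      · simp only [cuspPoint]
        rw [Real.exp_log (by positivity)]
        simp
  obtain ⟨p, hp, γ₁, h₁, e₁, i₁⟩ := key z hz
  obtain ⟨q, hq, γ₂, h₂, e₂, i₂⟩ := key _ hγz
  have : p = q := by
    refine hR hp hq ?_
    simp only
    rw [← e₁, ← e₂]
    refine Quotient.sound' ⟨⟨γ₁ * γ⁻¹ * γ₂⁻¹, Γ.mul_mem (Γ.mul_mem h₁ (Γ.inv_mem hγ))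
      (Γ.inv_mem h₂)⟩, ?_⟩
    change (γ₁ * γ⁻¹ * γ₂⁻¹) • γ₂ • γ • z = γ₁ • z
    simp [mul_smul]
  rw [← i₁, ← i₂, e₁, e₂, this]

/-- The lower left entries of elements of `Γ` are bounded away from zero. -/
theorem le_abs_lower_left (hcusp : cuspStabilizer Γ = Subgroup.closure {translation, -1})
    {R : ℝ} (hR : IsCuspRegion Γ R) {γ : SL(2, ℝ)} (hγ : γ ∈ Γ)
    (h0 : γ 1 0 ≠ 0) : (Real.exp R / (2 * Real.pi))⁻¹ ≤ |γ 1 0| := by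
  have hpi := Real.pi_pos
  set Y := Real.exp R / (2 * Real.pi) with hY
  have hY0 : 0 < Y := by positivity
  by_contra! hlt
  have hc : 0 < |γ 1 0| := abs_pos.2 h0
  set c := |γ 1 0|
  have hYc : Y < c⁻¹ := by rwa [lt_inv_comm₀ hY0 hc]
  obtain ⟨y, hy1, hy2⟩ := exists_between hYc
  have hy0 : 0 < y := hY0.trans hy1
  -- Above the pole `-d/c` at height `y` between `Y` and `1/|c|`, the image has height `1/(c² y) >
  -- y`: two points of one orbit in the cusp region at different heights.
  let z : ℍ := ⟨⟨-(γ 1 1) / γ 1 0, y⟩, hy0⟩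
  have hd : den γ z = (γ 1 0 * y : ℝ) * Complex.I := by
    apply Complex.ext
    · simp [den, z]; field_simp; ring
    · simp [den, z]
  have him : (γ • z).im = y / (c * y) ^ 2 := by
    rw [im_smul_eq, hd, norm_mul, Complex.norm_I, Complex.norm_real, mul_one, Real.norm_eq_abs,
      abs_mul, abs_of_pos hy0]
    rfl
  have hcy : c * y < 1 := by
    calc c * y < c * c⁻¹ := by gcongr
      _ = 1 := mul_inv_cancel₀ hc.ne'
  have hgt : y < (γ • z).im := by
    rw [him, lt_div_iff₀ (by positivity)]
    have : (c * y) ^ 2 < 1 := by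
      rw [sq_lt_one_iff₀ (by positivity)]; exact hcy
    nlinarith
  exact hgt.ne' (im_smul_eq_of_lt hcusp hR hγ hy1 (hy1.trans hgt))

/-- The determinant of two first columns is the lower left entry of `(rep x)⁻¹ * rep y`, which
vanishes only when the cosets agree. -/
theorem pairwise_le_det_rep (hcusp : cuspStabilizer Γ = Subgroup.closure {translation, -1})
    {R : ℝ} (hR : IsCuspRegion Γ R) :
    Pairwise fun x y : CuspCosets Γ => (Real.exp R / (2 * Real.pi))⁻¹ ≤
      |rep x 0 0 * rep y 1 0 - rep y 0 0 * rep x 1 0| := by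
  intro x y hxy
  have e : ((rep x)⁻¹ * rep y) 1 0 = rep x 0 0 * rep y 1 0 - rep y 0 0 * rep x 1 0 := by
    simp [Matrix.mul_apply, Fin.sum_univ_two, Matrix.SpecialLinearGroup.coe_inv,
      Matrix.adjugate_fin_two]
    ring
  have hm : (rep x)⁻¹ * rep y ∈ Γ := Γ.mul_mem (Γ.inv_mem (rep_mem x)) (rep_mem y)
  rw [← e]
  refine le_abs_lower_left hcusp hR hm fun h0 => hxy ?_
  rw [← (mk_eq_iff x.out y).2 (mem_cuspStabilizer_iff.2 ⟨hm, h0⟩)]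
  exact (Quotient.out_eq' x).symm

theorem column_sq_pos (g : SL(2, ℝ)) : 0 < g 0 0 ^ 2 + g 1 0 ^ 2 := by
  have := det_eq_one g
  by_contra! h
  have h0 : g 0 0 = 0 := by nlinarith [sq_nonneg (g 0 0), sq_nonneg (g 1 0)]
  have h1 : g 1 0 = 0 := by nlinarith [sq_nonneg (g 0 0), sq_nonneg (g 1 0)]
  rw [h0, h1] at this
  simp at this

theorem isFiniteMeasure_muHat [DiscreteTopology Γ]
    (hcusp : cuspStabilizer Γ = Subgroup.closure {translation, -1}) {R : ℝ} (hR : IsCuspRegion Γ R) {ν : ℝ}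
    (hν : 0 < ν) : IsFiniteMeasure (muHat Γ ν) := by
  have := countable_of_discrete Γ
  have : Countable (CuspCosets Γ) := Quotient.countable
  refine ⟨?_⟩
  rw [muHat, Measure.sum_apply _ MeasurableSet.univ]
  simp only [Measure.smul_apply, smul_eq_mul, measure_univ, mul_one]
  have hpi := Real.pi_pos
  refine tsum_inv_norm_rpow_lt_top (c := (Real.exp R / (2 * Real.pi))⁻¹) (by positivity)
    (by linarith) (pairwise_le_det_rep hcusp hR) fun x => ?_
  have := column_sq_pos (rep x)
  by_contra! h
  simp [h.1, h.2] at this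

end Cosets

/-! ### Equivariance of the boundary measure -/

theorem isUnit_det_cayley : IsUnit cayley.det := by
  rw [cayley, Matrix.det_fin_two_of, isUnit_iff_ne_zero]
  ring_nf
  simp

theorem cayley_inv : cayley⁻¹ = !![1 / 2, 1 / 2; Complex.I / 2, -Complex.I / 2] := by
  have hI := Complex.I_mul_I
  refine Matrix.inv_eq_right_inv ?_
  rw [cayley, Matrix.mul_fin_two, Matrix.one_fin_two]
  congr <;> first
    | linear_combination -(1 / 2 : ℂ) * hI
    | linear_combination (1 / 2 : ℂ) * hI

theorem norm_sq_add_mul_I (x y : ℝ) : ‖(x : ℂ) + y * Complex.I‖ ^ 2 = x ^ 2 + y ^ 2 := by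
  rw [← Complex.normSq_eq_norm_sq, Complex.normSq_add_mul_I]

theorem ballPoint_smul_infty (g : SL(2, ℝ)) : ballPoint (g • (∞ : OnePoint ℝ)) =
    ((g 0 0 : ℂ) - g 1 0 * Complex.I) / ((g 0 0 : ℂ) + g 1 0 * Complex.I) := by
  rw [smul_infty_eq]
  split_ifs with h
  · have h0 : (g 0 0 : ℂ) ≠ 0 := by
      have := column_sq_pos g
      rintro h1
      simp [h, Complex.ofReal_eq_zero.1 h1] at this
    change (1 : ℂ) = _
    simp [h, h0]
  · have h0 : (g 1 0 : ℂ) ≠ 0 := by exact_mod_cast h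
    change (((g 0 0 / g 1 0 : ℝ) : ℂ) - Complex.I) / (((g 0 0 / g 1 0 : ℝ) : ℂ) + Complex.I) = _
    rw [← mul_div_mul_right _ _ h0]
    push_cast
    congr 1 <;> field_simp

/-- The derivative of `γ` in the ball model, at the boundary point of the vector `(a, c)`, is
`|(a, c)|² / |γ (a, c)|²`. -/
theorem ballDeriv_smul_infty (γ g : SL(2, ℝ)) : ballDeriv γ (g • (∞ : OnePoint ℝ)) =
    (g 0 0 ^ 2 + g 1 0 ^ 2) / ((γ * g) 0 0 ^ 2 + (γ * g) 1 0 ^ 2) := by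
  have hI := Complex.I_ne_zero
  have hI2 := Complex.I_sq
  have hg := column_sq_pos g
  have hγg := column_sq_pos (γ * g)
  have hv : (g 0 0 : ℂ) + g 1 0 * Complex.I ≠ 0 := by
    rw [← norm_ne_zero_iff, ← pow_ne_zero_iff two_ne_zero, norm_sq_add_mul_I]; exact hg.ne'
  have hγv : ((γ * g) 0 0 : ℂ) + (γ * g) 1 0 * Complex.I ≠ 0 := by
    rw [← norm_ne_zero_iff, ← pow_ne_zero_iff two_ne_zero, norm_sq_add_mul_I]; exact hγg.ne'
  rw [ballDeriv, ballPoint_smul_infty]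
  set w := ((g 0 0 : ℂ) - g 1 0 * Complex.I) / ((g 0 0 : ℂ) + g 1 0 * Complex.I) with hw
  set m : Matrix (Fin 2) (Fin 2) ℂ :=
    cayley * (γ : Matrix (Fin 2) (Fin 2) ℝ).map ((↑) : ℝ → ℂ) * cayley⁻¹ with hm
  -- Conjugation keeps determinant `1`, so the derivative is the inverse square of the denominator.
  have hdet : m 0 0 * m 1 1 - m 0 1 * m 1 0 = 1 := by
    have hd : ((γ : Matrix (Fin 2) (Fin 2) ℝ).map ((↑) : ℝ → ℂ)).det = 1 := by
      have := (Complex.ofRealHom.map_det (γ : Matrix (Fin 2) (Fin 2) ℝ)).symm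
      rwa [γ.det_coe, map_one] at this
    rw [← Matrix.det_fin_two, hm, Matrix.det_conj ((Matrix.isUnit_iff_isUnit_det _).2
      isUnit_det_cayley), hd]
  -- The point `w` has homogeneous coordinates `(a - ic, a + ic)`, the Cayley image of `(a, c)`, so
  -- the denominator is the ratio of the second coordinates after and before applying `γ`.
  have hden : m 1 0 * w + m 1 1 =
      (((γ * g) 0 0 : ℂ) + (γ * g) 1 0 * Complex.I) / ((g 0 0 : ℂ) + g 1 0 * Complex.I) := by
    rw [hm, cayley_inv, cayley, Matrix.eta_fin_two (Matrix.map _ _), Matrix.mul_fin_two,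
      Matrix.mul_fin_two, hw, mul_div_assoc', div_add' _ _ _ hv]
    congr 1
    simp [Matrix.mul_apply, Fin.sum_univ_two]
    ring_nf
    simp only [hI2, Complex.I_pow_three]
    ring
  have hder : HasDerivAt (ballMap γ)
      ((m 0 0 * (m 1 0 * w + m 1 1) - (m 0 0 * w + m 0 1) * m 1 0) / (m 1 0 * w + m 1 1) ^ 2) w := by
    have h1 : HasDerivAt (fun w => m 0 0 * w + m 0 1) (m 0 0) w := by
      simpa using ((hasDerivAt_id w).const_mul (m 0 0)).add_const (m 0 1)
    have h2 : HasDerivAt (fun w => m 1 0 * w + m 1 1) (m 1 0) w := by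
      simpa using ((hasDerivAt_id w).const_mul (m 1 0)).add_const (m 1 1)
    exact h1.div h2 (by rw [hden]; exact div_ne_zero hγv hv)
  have hnum : m 0 0 * (m 1 0 * w + m 1 1) - (m 0 0 * w + m 0 1) * m 1 0 = 1 := by
    rw [← hdet]; ring
  rw [hder.deriv, hnum, hden, norm_div, norm_one, norm_pow, norm_div, div_pow, norm_sq_add_mul_I,
    norm_sq_add_mul_I, one_div_div]

section Equivariance

variable {Γ : Subgroup SL(2, ℝ)}

theorem rep_coe_smul_infty (γ : Γ) :
    rep (γ : CuspCosets Γ) • (∞ : OnePoint ℝ) = (γ : SL(2, ℝ)) • (∞ : OnePoint ℝ) := by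
  have h := ((mk_eq_iff γ γ).1 rfl).2
  change (γ : SL(2, ℝ))⁻¹ * rep (γ : CuspCosets Γ) ∈ MulAction.stabilizer SL(2, ℝ) (∞ : OnePoint ℝ)
    at h
  rwa [MulAction.mem_stabilizer_iff, mul_smul, inv_smul_eq_iff] at h

theorem rep_smul_smul_infty (γ : Γ) (x : CuspCosets Γ) :
    rep (γ • x) • (∞ : OnePoint ℝ) = (γ : SL(2, ℝ)) • rep x • (∞ : OnePoint ℝ) := by
  have h : γ • x = ((γ * x.out : Γ) : CuspCosets Γ) := by
    conv_lhs => rw [← Quotient.out_eq' x]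
    rfl
  rw [h, rep_coe_smul_infty, Subgroup.coe_mul, mul_smul]
  rfl

theorem column_sq_rep_smul (hcusp : cuspStabilizer Γ = Subgroup.closure {translation, -1})
    (γ : Γ) (x : CuspCosets Γ) : rep (γ • x) 0 0 ^ 2 + rep (γ • x) 1 0 ^ 2 =
      ((γ : SL(2, ℝ)) * rep x) 0 0 ^ 2 + ((γ : SL(2, ℝ)) * rep x) 1 0 ^ 2 := by
  have h : γ • x = ((γ * x.out : Γ) : CuspCosets Γ) := by
    conv_lhs => rw [← Quotient.out_eq' x]
    rfl
  rw [h, ← column_sq_eq_rep hcusp, Subgroup.coe_mul]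
  rfl

theorem lintegral_muHat (ν : ℝ) (f : OnePoint ℝ → ENNReal) : ∫⁻ q, f q ∂(muHat Γ ν) =
    ∑' x : CuspCosets Γ, ENNReal.ofReal
      (1 / ((rep x 0 0) ^ 2 + (rep x 1 0) ^ 2) ^ (2 * ν + 1)) * f (rep x • ∞) := by
  rw [muHat, lintegral_sum_measure]
  simp only [lintegral_smul_measure, lintegral_dirac, smul_eq_mul]

/-- Left multiplication by `γ` permutes the cosets and carries the atom at `x` to the atom at `γ •
x`; the ratio of the weights is the required power of the derivative. -/
theorem muHat_image (hcusp : cuspStabilizer Γ = Subgroup.closure {translation, -1})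
    [DiscreteTopology Γ] (ν : ℝ) {γ : SL(2, ℝ)} (hγ : γ ∈ Γ) {A : Set (OnePoint ℝ)}
    (hA : MeasurableSet A) : muHat Γ ν ((fun q => γ • q) '' A) =
      ∫⁻ q in A, ENNReal.ofReal (ballDeriv γ q ^ (2 * ν + 1)) ∂(muHat Γ ν) := by
  have := countable_of_discrete Γ
  have : Countable (CuspCosets Γ) := Quotient.countable
  rw [← lintegral_indicator hA, lintegral_muHat, muHat, Measure.sum_apply_of_countable,
    ← (MulAction.toPerm (⟨γ, hγ⟩ : Γ)).tsum_eq]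
  refine tsum_congr fun x => ?_
  rw [Measure.smul_apply, MulAction.toPerm_apply, column_sq_rep_smul hcusp, rep_smul_smul_infty,
    smul_eq_mul, Measure.dirac_apply]
  by_cases hx : rep x • (∞ : OnePoint ℝ) ∈ A
  · have h1 := column_sq_pos (rep x)
    have h2 := column_sq_pos (γ * rep x)
    rw [indicator_of_mem (mem_image_of_mem _ hx), indicator_of_mem hx, Pi.one_apply, mul_one,
      ballDeriv_smul_infty, ← ENNReal.ofReal_mul (by positivity), Real.div_rpow h1.le h2.le]
    congr 1
    field_simp
  · rw [indicator_of_notMem hx, mul_zero, indicator_of_notMem, mul_zero]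
    rintro ⟨q, hq, h⟩
    exact hx (MulAction.injective γ h ▸ hq)

end Equivariance

/-! ### Geodesics from the cusp -/

/-- A diagonal matrix acts as the dilation `z ↦ a² z`, a shift of time along the geodesic `i eᵗ`. -/
theorem smul_verticalGeodesic {k : SL(2, ℝ)} (h01 : k 0 1 = 0) (h10 : k 1 0 = 0) (t : ℝ) :
    k • verticalGeodesic t = verticalGeodesic (t + Real.log (k 0 0 ^ 2)) := by
  have hdet : k 0 0 * k 1 1 = 1 := by have := det_eq_one k; rwa [h01, zero_mul, sub_zero] at this
  have ha : k 0 0 ≠ 0 := left_ne_zero_of_mul_eq_one hdet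
  have hd : k 1 1 = (k 0 0)⁻¹ := eq_inv_of_mul_eq_one_right hdet
  have haC : (k 0 0 : ℂ) ≠ 0 := by exact_mod_cast ha
  have hden : den k (verticalGeodesic t).pt = ((k 0 0 : ℂ))⁻¹ := by simp [den, h10, hd]
  have hexp : Real.exp (t + Real.log (k 0 0 ^ 2)) = k 0 0 ^ 2 * Real.exp t := by
    rw [Real.exp_add, Real.exp_log (by positivity), mul_comm]
  have hexp' : Real.exp (-(t + Real.log (k 0 0 ^ 2))) = (k 0 0 ^ 2)⁻¹ * Real.exp (-t) := by
    rw [neg_add, Real.exp_add, Real.exp_neg (Real.log _), Real.exp_log (by positivity), mul_comm]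
  refine Cosphere.ext' ?_ ?_
  · rw [smul_pt, UpperHalfPlane.ext_iff, coe_smul_eq, hden, h01]
    change ((k 0 0 : ℂ) * (⟨0, Real.exp t⟩ : ℂ) + ((0 : ℝ) : ℂ)) / (k 0 0 : ℂ)⁻¹ =
      (⟨0, Real.exp (t + Real.log (k 0 0 ^ 2))⟩ : ℂ)
    rw [hexp, div_inv_eq_mul]
    apply Complex.ext <;> simp [-Complex.ofReal_exp]
    ring
  · rw [smul_cov, hden]
    change (⟨0, Real.exp (-t)⟩ : ℂ) * (starRingEnd ℂ (k 0 0 : ℂ)⁻¹) ^ 2 =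
      (⟨0, Real.exp (-(t + Real.log (k 0 0 ^ 2)))⟩ : ℂ)
    rw [hexp', map_inv₀, Complex.conj_ofReal, ← Complex.ofReal_inv, ← Complex.ofReal_pow]
    apply Complex.ext <;> simp [-Complex.ofReal_exp, -Complex.ofReal_inv, -Complex.ofReal_pow]
    ring

theorem flow_geodesic_apply (g : SL(2, ℝ)) (s t : ℝ) :
    flow t (geodesic g s) = geodesic g (s + t) := by
  let k : SL(2, ℝ) := ⟨!![Real.exp (s / 2), 0; 0, Real.exp (-(s / 2))], by
    rw [Matrix.det_fin_two_of, ← Real.exp_add]; simp⟩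
  have hk : ∀ u, k • verticalGeodesic u = verticalGeodesic (u + s) := by
    intro u
    have hlog : Real.log (k 0 0 ^ 2) = s := by
      change Real.log (Real.exp (s / 2) ^ 2) = s
      rw [← Real.exp_nat_mul, Real.log_exp]; push_cast; ring
    rw [smul_verticalGeodesic rfl rfl, hlog]
  have h : ∀ u, geodesic (g * k) u = geodesic g (u + s) := by
    intro u; rw [geodesic, mul_smul, hk]; rfl
  rw [← zero_add s, ← h, flow_geodesic, h, zero_add, add_comm]

/-- The inversion `z ↦ x - 1 / z`, which maps the geodesic from `0` to `∞` to the one from `∞`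
to `x`. -/
noncomputable def downward (x : ℝ) : SL(2, ℝ) := ⟨!![x, -1; 1, 0], by simp⟩

/-- `downward x` maps `i eˢ` to `x + i e⁻ˢ`, and the height `eʳ / (2π)` corresponds to `s = log (2π)
- r`. -/
theorem cuspCovector_eq_geodesic (r θ : ℝ) : cuspCovector r θ =
    geodesic (downward (θ / (2 * Real.pi))) (Real.log (2 * Real.pi) - r) := by
  have hpi := Real.pi_pos
  set x := θ / (2 * Real.pi) with hx
  set u := Real.log (2 * Real.pi) - r with hu
  have h1 : Real.exp (-u) = Real.exp r / (2 * Real.pi) := by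
    rw [hu, neg_sub, Real.exp_sub, Real.exp_log (by positivity)]
  have hE : (Real.exp u : ℂ) ≠ 0 := by exact_mod_cast (Real.exp_pos u).ne'
  have hI := Complex.I_ne_zero
  have hv : ((verticalGeodesic u).pt : ℂ) = Real.exp u * Complex.I := by
    apply Complex.ext <;> simp [verticalGeodesic, Cosphere.pt, -Complex.ofReal_exp]
  have hvc : (verticalGeodesic u).cov = (Real.exp u : ℂ)⁻¹ * Complex.I := by
    rw [← Complex.ofReal_inv, ← Real.exp_neg]
    apply Complex.ext <;> simp [verticalGeodesic, Cosphere.cov, -Complex.ofReal_exp]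
  have hd : den (downward x) (verticalGeodesic u).pt = Real.exp u * Complex.I := by
    rw [← hv]; simp [den, downward]
  have hc : (cuspPoint r θ : ℂ) = x + (Real.exp u : ℂ)⁻¹ * Complex.I := by
    rw [← Complex.ofReal_inv, ← Real.exp_neg, h1]
    apply Complex.ext <;> simp [cuspPoint, -Complex.ofReal_exp, -Complex.ofReal_div, hx]
  have him : (cuspPoint r θ).im = (Real.exp u)⁻¹ := by
    rw [← Real.exp_neg, h1]; rfl
  refine Cosphere.ext' ?_ ?_
  · change cuspPoint r θ = _
    rw [geodesic, smul_pt, UpperHalfPlane.ext_iff, hc, coe_smul_eq, hd, hv]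
    simp only [downward, Matrix.of_apply, Matrix.cons_val_zero, Matrix.cons_val_one,
      Matrix.cons_val', Matrix.cons_val_fin_one]
    push_cast at hE ⊢
    field_simp
    linear_combination Complex.I_sq
  · change -Complex.I / (cuspPoint r θ).im = _
    rw [geodesic, smul_cov, hd, hvc, him, map_mul, Complex.conj_I, Complex.conj_ofReal]
    push_cast at hE ⊢
    field_simp
    ring_nf
    simp only [Complex.I_sq]

theorem flow_cuspCovector (t r θ : ℝ) :
    flow t (cuspCovector r θ) = cuspCovector (r - t) θ := by
  rw [cuspCovector_eq_geodesic, flow_geodesic_apply, cuspCovector_eq_geodesic]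
  congr 1; ring

theorem continuous_cuspCovector : Continuous fun p : ℝ × ℝ => cuspCovector p.1 p.2 := by
  have hpi := Real.pi_pos
  have h1 : ∀ p : ℝ × ℝ, ((cuspCovector p.1 p.2).pt : ℂ) =
      ((p.2 / (2 * Real.pi) : ℝ) : ℂ) + ((Real.exp p.1 / (2 * Real.pi) : ℝ) : ℂ) * Complex.I := by
    intro p
    apply Complex.ext <;>
      simp [cuspCovector, cuspPoint, Cosphere.pt, -Complex.ofReal_exp, -Complex.ofReal_div]
  have h2 : ∀ p : ℝ × ℝ, (cuspCovector p.1 p.2).cov =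
      -Complex.I / ((Real.exp p.1 / (2 * Real.pi) : ℝ) : ℂ) := fun p => rfl
  refine Cosphere.continuous_of_coe ?_ ?_
  · simp only [h1]; fun_prop
  · simp only [h2]
    refine continuous_const.div (by fun_prop) fun p => ?_
    have : Real.exp p.1 / (2 * Real.pi) ≠ 0 := by positivity
    exact_mod_cast this

/-! ### The cusp measure -/

/-- The measure `e^{2νr} dr dθ`. -/
noncomputable def cuspWeight (ν : ℝ) : Measure (ℝ × ℝ) :=
  volume.withDensity fun p => ENNReal.ofReal (Real.exp (2 * ν * p.1))

/-- The fundamental strip of the cusp. -/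
noncomputable def cuspStrip : Set (ℝ × ℝ) := univ ×ˢ Ico 0 (2 * Real.pi)

theorem measurableSet_cuspStrip : MeasurableSet cuspStrip := MeasurableSet.univ.prod measurableSet_Ico

/-- The image in `S*M` of the measure `e^{2νr} dr dθ` on the covectors pointing away from the
cusp. -/
noncomputable def cuspMeasure (Γ : Subgroup SL(2, ℝ)) (ν : ℝ) : Measure (QuotCosphere Γ) :=
  Measure.map (fun p : ℝ × ℝ => proj Γ (cuspCovector p.1 p.2)) ((cuspWeight ν).restrict cuspStrip)

section CuspMeasure

variable {Γ : Subgroup SL(2, ℝ)}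

theorem continuous_proj_cuspCovector :
    Continuous fun p : ℝ × ℝ => proj Γ (cuspCovector p.1 p.2) :=
  (continuous_proj Γ).comp continuous_cuspCovector

theorem cuspWeight_strip_lt_top {ν : ℝ} (hν : 0 < ν) (r₀ : ℝ) :
    cuspWeight ν (Iic r₀ ×ˢ Ico 0 (2 * Real.pi)) < ⊤ := by
  rw [cuspWeight, withDensity_apply _ (measurableSet_Iic.prod measurableSet_Ico),
    Measure.volume_eq_prod, ← Measure.prod_restrict]
  have h := lintegral_prod_mul (μ := volume.restrict (Iic r₀))
    (ν := volume.restrict (Ico (0 : ℝ) (2 * Real.pi)))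
    (f := fun r => ENNReal.ofReal (Real.exp (2 * ν * r))) (g := fun _ => 1)
    (by fun_prop) aemeasurable_const
  simp only [mul_one] at h
  rw [h]
  refine ENNReal.mul_lt_top ?_ (by simp [ENNReal.mul_lt_top_iff])
  have hint : IntegrableOn (fun r => Real.exp (2 * ν * r)) (Iic r₀) :=
    integrableOn_exp_mul_Iic (by positivity) r₀
  exact (hasFiniteIntegral_iff_ofReal (ae_of_all _ fun r => (Real.exp_pos _).le)).1 hint.2

/-- Elements of `Γ` do not raise points of bounded height too far. -/
theorem im_smul_le (hcusp : cuspStabilizer Γ = Subgroup.closure {translation, -1})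
    {R : ℝ} (hR : IsCuspRegion Γ R) {γ : SL(2, ℝ)} (hγ : γ ∈ Γ) (z : ℍ) :
    (γ • z).im ≤ max z.im ((Real.exp R / (2 * Real.pi)) ^ 2 / z.im) := by
  have hpi := Real.pi_pos
  have hz := z.im_pos
  by_cases hc : γ 1 0 = 0
  · refine le_max_of_le_left ?_
    have h : γ ∈ cuspStabilizer Γ := mem_cuspStabilizer_iff.2 ⟨hγ, hc⟩
    rw [hcusp, mem_closure_translation_iff] at h
    have hd : ‖den γ z‖ = 1 := by
      obtain ⟨n, rfl | rfl⟩ := h <;> obtain ⟨-, -, h3, h4⟩ := translation_zpow_apply n <;>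
        simp [den, h3, h4]
    rw [im_smul_eq, hd]; simp
  -- For `c ≠ 0` one has `Im γz ≤ 1 / (c² Im z)`, and `|c| ≥ 1/Y`.
  · refine le_max_of_le_right ?_
    have h := le_abs_lower_left hcusp hR hγ hc
    set Y := Real.exp R / (2 * Real.pi) with hY
    have hY0 : 0 < Y := by positivity
    have hden : (γ 1 0 * z.im) ^ 2 ≤ ‖den γ z‖ ^ 2 := by
      rw [← Complex.normSq_eq_norm_sq, Complex.normSq_apply]
      have : (den γ z).im = γ 1 0 * z.im := by simp [den]
      rw [this]
      nlinarith [mul_self_nonneg (den γ z).re]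
    have hYc : 1 ≤ Y ^ 2 * γ 1 0 ^ 2 := by
      rw [inv_le_iff_one_le_mul₀' hY0] at h
      calc (1 : ℝ) = 1 ^ 2 := by norm_num
        _ ≤ (Y * |γ 1 0|) ^ 2 := by gcongr
        _ = _ := by rw [mul_pow, sq_abs]
    rw [im_smul_eq, div_le_div_iff₀ (by have := norm_pos_iff.2 (den_ne_zero γ z); positivity) hz]
    calc z.im * z.im = 1 * (z.im ^ 2) := by ring
      _ ≤ (Y ^ 2 * γ 1 0 ^ 2) * z.im ^ 2 := by gcongr
      _ = Y ^ 2 * (γ 1 0 * z.im) ^ 2 := by ring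
      _ ≤ _ := by gcongr

/-- A compact subset of `S*M` does not reach far into the cusp. -/
theorem exists_le_of_proj_mem (hcusp : cuspStabilizer Γ = Subgroup.closure {translation, -1})
    {R : ℝ} (hR : IsCuspRegion Γ R) {K : Set (QuotCosphere Γ)} (hK : IsCompact K) :
    ∃ r₀ : ℝ, ∀ r θ, proj Γ (cuspCovector r θ) ∈ K → r ≤ r₀ := by
  have hpi := Real.pi_pos
  -- These increasing open sets exhaust `S*M`, so one contains the compact set. Both height bounds
  -- matter: the lower one limits how high a `Γ`-translate can rise.
  let W : ℕ → Set (QuotCosphere Γ) := fun n =>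
    proj Γ '' {ρ | ρ.pt.im < n + 1 ∧ 1 < (n + 1) * ρ.pt.im}
  have him : Continuous fun ρ : Cosphere => ρ.pt.im :=
    UpperHalfPlane.continuous_im.comp Cosphere.continuous_pt
  have hWo : ∀ n, IsOpen (W n) := fun n => isOpenMap_proj Γ _
    ((isOpen_lt him continuous_const).inter (isOpen_lt continuous_const
      (continuous_const.mul him)))
  have hWm : Monotone W := by
    intro m n hmn
    refine image_mono ?_
    rintro ρ ⟨h1, h2⟩
    have : (m : ℝ) ≤ n := by exact_mod_cast hmn
    have := ρ.pt.im_pos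
    exact ⟨by linarith, by nlinarith⟩
  have hcov : K ⊆ ⋃ n, W n := by
    intro x _
    obtain ⟨ρ, rfl⟩ := surjective_proj Γ x
    have hρ := ρ.pt.im_pos
    obtain ⟨n, hn⟩ := exists_nat_gt (max ρ.pt.im (1 / ρ.pt.im))
    rw [max_lt_iff, div_lt_iff₀ hρ] at hn
    exact mem_iUnion.2 ⟨n, ρ, ⟨by linarith, by linarith⟩, rfl⟩
  obtain ⟨n, hn⟩ := hK.elim_directed_cover W hWo hcov (directed_of_isDirected_le hWm)
  set Y := Real.exp R / (2 * Real.pi)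
  refine ⟨Real.log (2 * Real.pi * max ((n : ℝ) + 1) (Y ^ 2 * (n + 1))), fun r θ h => ?_⟩
  obtain ⟨ρ, ⟨h1, h2⟩, h3⟩ := hn h
  obtain ⟨γ, hγ, e⟩ := (proj_eq_proj_iff Γ).1 h3.symm
  have hle := im_smul_le hcusp hR hγ ρ.pt
  rw [← smul_pt, e] at hle
  change Real.exp r / (2 * Real.pi) ≤ _ at hle
  have hρ := ρ.pt.im_pos
  have h4 : Y ^ 2 / ρ.pt.im ≤ Y ^ 2 * (n + 1) := by
    rw [div_le_iff₀ hρ]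
    nlinarith [sq_nonneg Y]
  have h5 := hle.trans (max_le_max h1.le h4)
  rw [div_le_iff₀' (by positivity)] at h5
  rwa [Real.le_log_iff_exp_le (by positivity)]

theorem isFiniteMeasureOnCompacts_cuspMeasure [DiscreteTopology Γ]
    (hcusp : cuspStabilizer Γ = Subgroup.closure {translation, -1})
    {R : ℝ} (hR : IsCuspRegion Γ R) {ν : ℝ} (hν : 0 < ν) :
    IsFiniteMeasureOnCompacts (cuspMeasure Γ ν) := by
  refine ⟨fun K hK => ?_⟩
  obtain ⟨r₀, h⟩ := exists_le_of_proj_mem hcusp hR hK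
  rw [cuspMeasure, Measure.map_apply continuous_proj_cuspCovector.measurable hK.measurableSet,
    Measure.restrict_apply' measurableSet_cuspStrip]
  refine (measure_mono ?_).trans_lt (cuspWeight_strip_lt_top hν r₀)
  rintro ⟨r, θ⟩ ⟨h1, -, h2⟩
  exact ⟨h r θ h1, h2⟩

theorem integral_cuspMeasure (ν : ℝ) {a : QuotCosphere Γ → ℝ} (ha : Continuous a) :
    ∫ x, a x ∂(cuspMeasure Γ ν) =
      ∫ p in cuspStrip, Real.exp (2 * ν * p.1) * a (proj Γ (cuspCovector p.1 p.2)) := by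
  rw [cuspMeasure, integral_map continuous_proj_cuspCovector.aemeasurable
    ha.aestronglyMeasurable, cuspWeight, restrict_withDensity measurableSet_cuspStrip,
    integral_withDensity_eq_integral_toReal_smul (by fun_prop) (by simp)]
  simp only [ENNReal.toReal_ofReal (Real.exp_pos _).le, smul_eq_mul]

theorem integrableOn_of_integrable_cuspMeasure (ν : ℝ) {a : QuotCosphere Γ → ℝ}
    (hc : Continuous a) (ha : Integrable a (cuspMeasure Γ ν)) :
    IntegrableOn (fun p : ℝ × ℝ => Real.exp (2 * ν * p.1) * a (proj Γ (cuspCovector p.1 p.2)))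
      cuspStrip := by
  rw [cuspMeasure, integrable_map_measure hc.aestronglyMeasurable
    continuous_proj_cuspCovector.aemeasurable, cuspWeight,
    restrict_withDensity measurableSet_cuspStrip,
    integrable_withDensity_iff_integrable_smul' (by fun_prop) (by simp)] at ha
  simp only [ENNReal.toReal_ofReal (Real.exp_pos _).le, smul_eq_mul] at ha
  exact ha

/-- After the change of variable only the domain depends on `t`; it increases to the strip, and
dominated convergence applies with the integrand on the strip as bound. -/
theorem isCuspMeasure_cuspMeasure [DiscreteTopology Γ]
    (hcusp : cuspStabilizer Γ = Subgroup.closure {translation, -1})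
    {R : ℝ} (hR : IsCuspRegion Γ R) {ν : ℝ} (hν : 0 < ν) :
    IsCuspMeasure Γ R ν (cuspMeasure Γ ν) := by
  have hfin := isFiniteMeasureOnCompacts_cuspMeasure hcusp hR hν
  refine ⟨inferInstance, fun a hac hasupp => ?_⟩
  have hint := integrableOn_of_integrable_cuspMeasure ν hac
    (hac.integrable_of_hasCompactSupport hasupp)
  rw [integral_cuspMeasure ν hac]
  set F : ℝ × ℝ → ℝ := fun p => Real.exp (2 * ν * p.1) * a (proj Γ (cuspCovector p.1 p.2)) with hF
  have hFc : Continuous F := by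
    have := hac.comp (continuous_proj_cuspCovector (Γ := Γ))
    exact (by fun_prop : Continuous fun p : ℝ × ℝ => Real.exp (2 * ν * p.1)).mul this
  have hset : ∀ t : ℝ, MeasurableSet (Ioi t ×ˢ Ico (0 : ℝ) (2 * Real.pi)) := fun t =>
    measurableSet_Ioi.prod measurableSet_Ico
  have hshift : ∀ t : ℝ, Real.exp (-2 * ν * t) * ∫ p in Ioi R ×ˢ Ico 0 (2 * Real.pi),
      Real.exp (2 * ν * p.1) * a (quotFlow Γ t (proj Γ (cuspCovector p.1 p.2))) =
      ∫ p, (Ioi (R - t) ×ˢ Ico 0 (2 * Real.pi)).indicator F p := by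
    intro t
    rw [← integral_const_mul, ← integral_indicator (hset R),
      ← integral_add_right_eq_self _ ((t, 0) : ℝ × ℝ)]
    congr 1
    funext p
    have hmem : p + (t, 0) ∈ Ioi R ×ˢ Ico 0 (2 * Real.pi) ↔
        p ∈ Ioi (R - t) ×ˢ Ico 0 (2 * Real.pi) := by
      simp [sub_lt_iff_lt_add]
    by_cases hp : p ∈ Ioi (R - t) ×ˢ Ico 0 (2 * Real.pi)
    · rw [indicator_of_mem hp, indicator_of_mem (hmem.2 hp), hF]
      change Real.exp (-2 * ν * t) * (Real.exp (2 * ν * (p.1 + t)) *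
        a (proj Γ (flow t (cuspCovector (p.1 + t) (p.2 + 0))))) = _
      rw [flow_cuspCovector, add_zero, add_sub_cancel_right, ← mul_assoc, ← Real.exp_add]
      congr 2; ring
    · rw [indicator_of_notMem hp, indicator_of_notMem (mt hmem.1 hp)]
  simp only [hshift]
  rw [← integral_indicator measurableSet_cuspStrip]
  refine tendsto_integral_filter_of_dominated_convergence (cuspStrip.indicator fun p => ‖F p‖)
    (Eventually.of_forall fun t => hFc.aestronglyMeasurable.indicator (hset _))
    (Eventually.of_forall fun t => ae_of_all _ fun p => ?_)
    ((integrable_indicator_iff measurableSet_cuspStrip).2 hint.norm) (ae_of_all _ fun p => ?_)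
  · rw [norm_indicator_eq_indicator_norm]
    exact indicator_le_indicator_of_subset (prod_mono (subset_univ _) subset_rfl)
      (fun _ => norm_nonneg _) p
  · refine tendsto_const_nhds.congr' ?_
    filter_upwards [eventually_gt_atTop (R - p.1)] with t ht
    by_cases hp : p.2 ∈ Ico 0 (2 * Real.pi)
    · have h1 : p ∈ cuspStrip := ⟨mem_univ _, hp⟩
      have h2 : p ∈ Ioi (R - t) ×ˢ Ico 0 (2 * Real.pi) := ⟨by rw [mem_Ioi]; linarith, hp⟩
      rw [indicator_of_mem h1, indicator_of_mem h2]
    · have h1 : p ∉ cuspStrip := fun h => hp h.2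
      have h2 : p ∉ Ioi (R - t) ×ˢ Ico 0 (2 * Real.pi) := fun h => hp h.2
      rw [indicator_of_notMem h1, indicator_of_notMem h2]

theorem IsCuspMeasure.unique [DiscreteTopology Γ] {R ν : ℝ} {μ₁ μ₂ : Measure (QuotCosphere Γ)}
    (h₁ : IsCuspMeasure Γ R ν μ₁) (h₂ : IsCuspMeasure Γ R ν μ₂) : μ₁ = μ₂ := by
  have := h₁.regular
  have := h₂.regular
  exact Measure.ext_of_integral_eq_on_compactlySupported fun f =>
    tendsto_nhds_unique (h₁.tendsto f f.continuous f.hasCompactSupport)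
      (h₂.tendsto f f.continuous f.hasCompactSupport)

end CuspMeasure

/-! ### The lift of the cusp measure -/

section Lift

variable {Γ : Subgroup SL(2, ℝ)}

theorem neg_smul_cosphere (g : SL(2, ℝ)) (ρ : Cosphere) : -g • ρ = g • ρ := by
  rw [← neg_one_mul, mul_smul, neg_one_smul_cosphere]

theorem neg_smul_onePoint (g : SL(2, ℝ)) (q : OnePoint ℝ) : -g • q = g • q := by
  rw [← neg_one_mul, mul_smul]
  generalize g • q = q
  change (Matrix.SpecialLinearGroup.toGL (-1 : SL(2, ℝ))) • q = q
  induction q using OnePoint.rec with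
  | infty => rw [OnePoint.smul_infty_eq_ite]; simp
  | coe x => rw [OnePoint.smul_some_eq_ite]; simp

theorem translation_zpow_smul_cuspCovector (n : ℤ) (r θ : ℝ) :
    translation ^ n • cuspCovector r θ = cuspCovector r (θ + n * (2 * Real.pi)) := by
  have hpi := Real.pi_pos
  obtain ⟨h1, h2, h3, h4⟩ := translation_zpow_apply n
  have hd : den (translation ^ n) (cuspCovector r θ).pt = 1 := by simp [den, h3, h4]
  refine Cosphere.ext' ?_ ?_
  · rw [smul_pt, UpperHalfPlane.ext_iff, coe_smul_eq, hd, h1, h2]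
    apply Complex.ext
    · simp [cuspCovector, cuspPoint, Cosphere.pt]; field_simp
    · simp [cuspCovector, cuspPoint, Cosphere.pt]
  · rw [smul_cov, hd, map_one, one_pow, mul_one]
    rfl

/-- By freeness the two matrices agree up to sign. Their values at `∞` give `x = y`, and the upper
left entries `1` of the translations exclude the minus sign. -/
theorem eq_of_smul_eq {x y : CuspCosets Γ} {m n : ℤ} {ρ : Cosphere}
    (h : (rep x * translation ^ m) • ρ = (rep y * translation ^ n) • ρ) : x = y ∧ m = n := by
  have hT : ∀ k : ℤ, translation ^ k • (∞ : OnePoint ℝ) = ∞ := fun k =>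
    (smul_infty_eq_infty_iff _).2 (translation_zpow_apply k).2.2.1
  obtain ⟨m1, m2, -, -⟩ := translation_zpow_apply m
  obtain ⟨n1, n2, -, -⟩ := translation_zpow_apply n
  rw [← inv_smul_eq_iff, ← mul_smul, smul_eq_self_iff] at h
  rcases h with h | h
  · rw [inv_mul_eq_one] at h
    have hxy : x = y := injective_rep_smul_infty (by
      have := congrArg (· • (∞ : OnePoint ℝ)) h
      simpa only [mul_smul, hT] using this.symm)
    subst hxy
    have := mul_left_cancel h
    refine ⟨rfl, ?_⟩
    rw [this, m2] at n2
    exact_mod_cast n2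
  · rw [inv_mul_eq_iff_eq_mul, mul_neg_one] at h
    have hxy : x = y := injective_rep_smul_infty (by
      have := congrArg (· • (∞ : OnePoint ℝ)) h
      simpa only [neg_smul_onePoint, mul_smul, hT] using this)
    subst hxy
    rw [← mul_neg] at h
    rw [mul_left_cancel h, Matrix.SpecialLinearGroup.coe_neg, Matrix.neg_apply, n1] at m1
    norm_num at m1

/-- The double sum counts the points of the orbit of `ρ` in `A`, each once. As the projection is
injective on `A`, the count is `1` or `0`. -/
theorem tsum_indicator_smul (hcusp : cuspStabilizer Γ = Subgroup.closure {translation, -1})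
    {A : Set Cosphere} (hA : InjOn (proj Γ) A) (ρ : Cosphere) :
    ∑' (x : CuspCosets Γ) (n : ℤ), A.indicator (1 : Cosphere → ENNReal)
      ((rep x * translation ^ n) • ρ) = (proj Γ '' A).indicator 1 (proj Γ ρ) := by
  have hproj : ∀ (x : CuspCosets Γ) (n : ℤ),
      proj Γ ((rep x * translation ^ n) • ρ) = proj Γ ρ := fun x n =>
    (proj_eq_proj_iff Γ).2 ⟨_, Γ.mul_mem (rep_mem x) (translation_zpow_mem hcusp n), rfl⟩
  rw [← ENNReal.tsum_prod (f := fun (x : CuspCosets Γ) (n : ℤ) =>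
    A.indicator (1 : Cosphere → ENNReal) ((rep x * translation ^ n) • ρ))]
  by_cases h : proj Γ ρ ∈ proj Γ '' A
  · obtain ⟨σ, hσ, e⟩ := h
    rw [indicator_of_mem (show proj Γ ρ ∈ proj Γ '' A from ⟨σ, hσ, e⟩)]
    obtain ⟨γ, hγ, rfl⟩ := (proj_eq_proj_iff Γ).1 e
    obtain ⟨n, hn⟩ := exists_eq_rep_mul hcusp ⟨γ, hγ⟩
    set x : CuspCosets Γ := ((⟨γ, hγ⟩ : Γ) : CuspCosets Γ)
    have hγρ : γ • ρ = (rep x * translation ^ n) • ρ := by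
      rcases hn with hn | hn
      · exact congrArg (· • ρ) hn
      · exact (congrArg (· • ρ) hn).trans (neg_smul_cosphere _ _)
    rw [hγρ] at hσ
    rw [tsum_eq_single (x, n), indicator_of_mem hσ]
    · rfl
    · rintro ⟨y, m⟩ hne
      refine indicator_of_notMem (fun hy => hne ?_) _
      obtain ⟨rfl, rfl⟩ := eq_of_smul_eq (hA hy hσ ((hproj _ _).trans (hproj _ _).symm))
      rfl
  · rw [indicator_of_notMem h, ENNReal.tsum_eq_zero]
    exact fun p => indicator_of_notMem (fun hp => h ⟨_, hp, hproj _ _⟩) _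

/-- The `2π`-translates of the strip tile the plane, and the weight does not depend on `θ`. -/
theorem lintegral_cuspWeight_eq_tsum (ν : ℝ) {f : ℝ × ℝ → ENNReal} (hf : Measurable f) :
    ∫⁻ p, f p ∂(cuspWeight ν) =
      ∑' n : ℤ, ∫⁻ p in cuspStrip, f (p.1, p.2 + n * (2 * Real.pi)) ∂(cuspWeight ν) := by
  have hpi := Real.two_pi_pos
  let S : ℤ → Set (ℝ × ℝ) := fun n =>
    univ ×ˢ Ico (0 + n • (2 * Real.pi)) (0 + (n + 1) • (2 * Real.pi))
  have hS : ∀ n, MeasurableSet (S n) := fun n => MeasurableSet.univ.prod measurableSet_Ico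
  have hdisj : Pairwise (Function.onFun Disjoint S) := fun m n hmn =>
    (pairwise_disjoint_Ico_add_zsmul (0 : ℝ) (2 * Real.pi) hmn).set_prod_right _ _
  have hcov : ⋃ n, S n = univ := by
    rw [← prod_iUnion, iUnion_Ico_add_zsmul hpi, univ_prod_univ]
  have hw : Measurable fun p : ℝ × ℝ => ENNReal.ofReal (Real.exp (2 * ν * p.1)) := by fun_prop
  rw [← setLIntegral_univ, ← hcov, lintegral_iUnion hS hdisj]
  refine tsum_congr fun n => ?_
  have hg : Measurable fun p : ℝ × ℝ => f (p.1, p.2 + n * (2 * Real.pi)) :=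
    hf.comp (by fun_prop)
  rw [cuspWeight, setLIntegral_withDensity_eq_setLIntegral_mul _ hw hf (hS n),
    setLIntegral_withDensity_eq_setLIntegral_mul _ hw hg measurableSet_cuspStrip,
    ← lintegral_indicator (hS n), ← lintegral_indicator measurableSet_cuspStrip,
    ← lintegral_add_right_eq_self _ ((0, n * (2 * Real.pi)) : ℝ × ℝ)]
  congr 1
  funext p
  have hmem : p + (0, n * (2 * Real.pi)) ∈ S n ↔ p ∈ cuspStrip := by
    simp only [S, cuspStrip, mem_prod, mem_univ, true_and, mem_Ico, Prod.snd_add, zsmul_eq_mul]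
    push_cast
    constructor <;> rintro ⟨h1, h2⟩ <;> constructor <;> linarith
  by_cases hp : p ∈ cuspStrip
  · rw [indicator_of_mem hp, indicator_of_mem (hmem.2 hp)]
    change ENNReal.ofReal (Real.exp (2 * ν * (p.1 + 0))) *
      f (p.1 + 0, p.2 + n * (2 * Real.pi)) = _
    rw [add_zero]
    rfl
  · rw [indicator_of_notMem hp, indicator_of_notMem (mt hmem.1 hp)]

/-- The sum over the cosets of the translates of `e^{2νr} dr dθ`. -/
noncomputable def liftMeasure (Γ : Subgroup SL(2, ℝ)) (ν : ℝ) : Measure Cosphere :=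
  Measure.sum fun x : CuspCosets Γ =>
    Measure.map (fun p : ℝ × ℝ => rep x • cuspCovector p.1 p.2) (cuspWeight ν)

theorem measurable_smul_cuspCovector (g : SL(2, ℝ)) :
    Measurable fun p : ℝ × ℝ => g • cuspCovector p.1 p.2 :=
  (continuous_cuspCovector.const_smul g).measurable

theorem isLift_liftMeasure [DiscreteTopology Γ]
    (hcusp : cuspStabilizer Γ = Subgroup.closure {translation, -1}) (ν : ℝ) :
    IsLift Γ (cuspMeasure Γ ν) (liftMeasure Γ ν) := by
  intro A hA hinj
  have := countable_of_discrete Γ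
  have : Countable (CuspCosets Γ) := Quotient.countable
  -- An injective continuous image of a Borel set of a Polish space is Borel (Lusin–Souslin).
  have hpA : MeasurableSet (proj Γ '' A) :=
    hA.image_of_continuousOn_injOn (continuous_proj Γ).continuousOn hinj
  have hind : Measurable (A.indicator (1 : Cosphere → ENNReal)) := measurable_one.indicator hA
  have hm : ∀ g : SL(2, ℝ), Measurable fun p : ℝ × ℝ =>
      A.indicator (1 : Cosphere → ENNReal) (g • cuspCovector p.1 p.2) := fun g =>
    hind.comp (measurable_smul_cuspCovector g)
  calc liftMeasure Γ ν A
      = ∑' x : CuspCosets Γ, ∫⁻ p, A.indicator 1 (rep x • cuspCovector p.1 p.2) ∂(cuspWeight ν) := by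
        rw [liftMeasure, Measure.sum_apply _ hA]
        refine tsum_congr fun x => ?_
        rw [← lintegral_indicator_one hA, lintegral_map hind (measurable_smul_cuspCovector _)]
    _ = ∑' (x : CuspCosets Γ) (n : ℤ), ∫⁻ p in cuspStrip,
          A.indicator 1 ((rep x * translation ^ n) • cuspCovector p.1 p.2) ∂(cuspWeight ν) := by
        refine tsum_congr fun x => ?_
        rw [lintegral_cuspWeight_eq_tsum ν (hm (rep x))]
        simp only [mul_smul, translation_zpow_smul_cuspCovector]
    _ = ∫⁻ p in cuspStrip, ∑' (x : CuspCosets Γ) (n : ℤ),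
          A.indicator 1 ((rep x * translation ^ n) • cuspCovector p.1 p.2) ∂(cuspWeight ν) := by
        rw [lintegral_tsum fun x => (Measurable.tsum fun n => hm _).aemeasurable]
        refine tsum_congr fun x => ?_
        rw [lintegral_tsum fun n => (hm _).aemeasurable]
    _ = ∫⁻ p in cuspStrip, (proj Γ '' A).indicator 1 (proj Γ (cuspCovector p.1 p.2))
          ∂(cuspWeight ν) := by
        simp only [tsum_indicator_smul hcusp hinj]
    _ = cuspMeasure Γ ν (proj Γ '' A) := by
        rw [cuspMeasure, ← lintegral_indicator_one hpA,
          lintegral_map (measurable_one.indicator hpA) continuous_proj_cuspCovector.measurable]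

theorem isLift_iff_eq [DiscreteTopology Γ] {μ : Measure (QuotCosphere Γ)}
    {μ₁ : Measure Cosphere} (h₁ : IsLift Γ μ μ₁) (μ₂ : Measure Cosphere) :
    IsLift Γ μ μ₂ ↔ μ₂ = μ₁ := by
  refine ⟨fun h₂ => ext_of_injOn_proj Γ fun A hA hinj => ?_, fun h => h ▸ h₁⟩
  rw [h₁ A hA hinj, h₂ A hA hinj]

end Lift

/-! ### The boundary parametrization -/

/-- A geodesic attached to `g` differs from the parametrization `𝒯` with the same end points by
a shift of time. -/
theorem boundaryParam_eq_geodesic {q : BoundaryPair} {g : SL(2, ℝ)}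
    (h₀ : g • ((0 : ℝ) : OnePoint ℝ) = q.1.1) (h₁ : g • (∞ : OnePoint ℝ) = q.1.2) (t : ℝ) :
    boundaryParam (q, t) = geodesic g (t + Real.log
      ((g 0 1 ^ 2 + g 1 1 ^ 2) / (g 0 0 ^ 2 + g 1 0 ^ 2)) / 2) := by
  obtain ⟨e₀, e₁, hmin⟩ := (exists_geodesic_closest q).choose_spec
  rw [boundaryParam]
  simp only
  set h := (exists_geodesic_closest q).choose
  -- Both matrices have the same end points, so `k` fixes `0` and `∞` and is diagonal: it shifts
  -- time.
  set k := g⁻¹ * h with hk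
  have hh : h = g * k := by rw [hk, mul_inv_cancel_left]
  have k₀ : k • ((0 : ℝ) : OnePoint ℝ) = ((0 : ℝ) : OnePoint ℝ) := by
    rw [hk, mul_smul, e₀, ← h₀, inv_smul_smul]
  have k₁ : k • (∞ : OnePoint ℝ) = ∞ := by rw [hk, mul_smul, e₁, ← h₁, inv_smul_smul]
  have k10 : k 1 0 = 0 := (smul_infty_eq_infty_iff k).1 k₁
  have hdet := det_eq_one k
  rw [k10, mul_zero, sub_zero] at hdet
  have k01 : k 0 1 = 0 := by
    rw [smul_zero_eq, if_neg (right_ne_zero_of_mul_eq_one hdet), OnePoint.coe_eq_coe,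
      div_eq_zero_iff] at k₀
    exact k₀.resolve_right (right_ne_zero_of_mul_eq_one hdet)
  have ha : k 0 0 ≠ 0 := left_ne_zero_of_mul_eq_one hdet
  have hd : k 1 1 = (k 0 0)⁻¹ := eq_inv_of_mul_eq_one_right hdet
  have n1 : h 0 0 ^ 2 + h 1 0 ^ 2 = k 0 0 ^ 2 * (g 0 0 ^ 2 + g 1 0 ^ 2) := by
    rw [hh]; simp [Matrix.mul_apply, Fin.sum_univ_two, k10]; ring
  have n2 : h 0 1 ^ 2 + h 1 1 ^ 2 = (k 0 0 ^ 2)⁻¹ * (g 0 1 ^ 2 + g 1 1 ^ 2) := by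
    rw [hh]; simp [Matrix.mul_apply, Fin.sum_univ_two, k01, hd]; ring
  have hN1 := column_sq_pos h
  have hN2 : 0 < h 0 1 ^ 2 + h 1 1 ^ 2 := by
    by_contra! hle
    have z0 : h 0 1 = 0 := by nlinarith [sq_nonneg (h 0 1), sq_nonneg (h 1 1)]
    have z1 : h 1 1 = 0 := by nlinarith [sq_nonneg (h 0 1), sq_nonneg (h 1 1)]
    have := det_eq_one h
    rw [z0, z1] at this
    simp at this
  have hg1 := column_sq_pos g
  -- The hyperbolic cosine of the distance to `i` is `(N1 eᵗ + N2 e⁻ᵗ) / 2`, with minimum `√(N1 N2)`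
  -- at `eᵗ = √N2 / √N1`. Minimality at `t = 0` is equality in the inequality of means, so `N1 =
  -- N2`.
  have heq : h 0 0 ^ 2 + h 1 0 ^ 2 = h 0 1 ^ 2 + h 1 1 ^ 2 := by
    set N1 := h 0 0 ^ 2 + h 1 0 ^ 2
    set N2 := h 0 1 ^ 2 + h 1 1 ^ 2
    have hm := hmin (Real.log (√N2 / √N1))
    replace hm := Real.cosh_le_cosh.2
      (abs_le_abs_of_nonneg (dist_nonneg (x := UpperHalfPlane.I) (y := (geodesic h 0).pt)) hm)
    rw [cosh_dist_geodesic, cosh_dist_geodesic, Real.exp_neg (Real.log _),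
      Real.exp_log (by positivity), neg_zero, Real.exp_zero] at hm
    have s1 : N1 * (√N2 / √N1) = √N1 * √N2 := by
      nth_rewrite 1 [← Real.mul_self_sqrt hN1.le]; field_simp
    have s2 : N2 * (√N2 / √N1)⁻¹ = √N1 * √N2 := by
      nth_rewrite 1 [← Real.mul_self_sqrt hN2.le]; field_simp
    rw [s1, s2] at hm
    have hsq : (√N1 - √N2) ^ 2 ≤ 0 := by
      rw [sub_sq, Real.sq_sqrt hN1.le, Real.sq_sqrt hN2.le]; linarith
    have h0 : √N1 - √N2 = 0 := by
      rw [← sq_eq_zero_iff]; exact le_antisymm hsq (sq_nonneg _)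
    exact (Real.sqrt_inj hN1.le hN2.le).1 (sub_eq_zero.1 h0)
  have hlog : Real.log (k 0 0 ^ 2) =
      Real.log ((g 0 1 ^ 2 + g 1 1 ^ 2) / (g 0 0 ^ 2 + g 1 0 ^ 2)) / 2 := by
    rw [n1, n2] at heq
    have : (g 0 1 ^ 2 + g 1 1 ^ 2) / (g 0 0 ^ 2 + g 1 0 ^ 2) = (k 0 0 ^ 2) ^ 2 := by
      rw [div_eq_iff hg1.ne']
      field_simp at heq
      linear_combination -heq
    rw [this, Real.log_pow (k 0 0 ^ 2) 2]; push_cast; ring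
  rw [hh, geodesic, mul_smul, smul_verticalGeodesic k01 k10, hlog]
  rfl

theorem coe_pt_geodesic (g : SL(2, ℝ)) (s : ℝ) : ((geodesic g s).pt : ℂ) =
    ((g 0 0 : ℂ) * (Real.exp s * Complex.I) + g 0 1) /
      ((g 1 0 : ℂ) * (Real.exp s * Complex.I) + g 1 1) := by
  have hv : ((verticalGeodesic s).pt : ℂ) = Real.exp s * Complex.I := by
    apply Complex.ext <;> simp [verticalGeodesic, Cosphere.pt, -Complex.ofReal_exp]
  rw [geodesic, smul_pt, coe_smul_eq, den, hv]

theorem cov_geodesic (g : SL(2, ℝ)) (s : ℝ) : (geodesic g s).cov =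
    (Real.exp (-s) * Complex.I) *
      (starRingEnd ℂ ((g 1 0 : ℂ) * (Real.exp s * Complex.I) + g 1 1)) ^ 2 := by
  have hv : ((verticalGeodesic s).pt : ℂ) = Real.exp s * Complex.I := by
    apply Complex.ext <;> simp [verticalGeodesic, Cosphere.pt, -Complex.ofReal_exp]
  have hvc : (verticalGeodesic s).cov = Real.exp (-s) * Complex.I := by
    apply Complex.ext <;> simp [verticalGeodesic, Cosphere.cov, -Complex.ofReal_exp]
  rw [geodesic, smul_cov, den, hv, hvc]

/-! ### Homogeneous coordinates and measurability -/

theorem measurableEmbedding_coe_onePoint : MeasurableEmbedding ((↑) : ℝ → OnePoint ℝ) :=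
  OnePoint.isOpenEmbedding_coe.measurableEmbedding

theorem measurable_of_comp_coe {α : Type*} [MeasurableSpace α] {f : OnePoint ℝ → α}
    (hf : Measurable fun x : ℝ => f x) : Measurable f := by
  intro S hS
  have h : f ⁻¹' S = ((↑) : ℝ → OnePoint ℝ) '' ((fun x : ℝ => f x) ⁻¹' S) ∪ (f ⁻¹' S ∩ {∞}) := by
    ext q
    induction q using OnePoint.rec <;> simp
  rw [h]
  refine (measurableEmbedding_coe_onePoint.measurableSet_image.2 (hf hS)).union
    (Set.Finite.measurableSet ?_)
  exact (finite_singleton _).subset inter_subset_right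

/-- The first homogeneous coordinate of a boundary point. -/
def homNum : OnePoint ℝ → ℝ
  | some x => x
  | none => 1

/-- The second homogeneous coordinate of a boundary point. -/
def homDen : OnePoint ℝ → ℝ
  | some _ => 1
  | none => 0

theorem measurable_homNum : Measurable homNum := measurable_of_comp_coe measurable_id

theorem measurable_homDen : Measurable homDen := measurable_of_comp_coe measurable_const

theorem eq_ite_homNum_div_homDen (q : OnePoint ℝ) :
    q = if homDen q = 0 then ∞ else ((homNum q / homDen q : ℝ) : OnePoint ℝ) := by
  induction q using OnePoint.rec with
  | infty => exact (if_pos rfl).symm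
  | coe x =>
    have h : homDen (x : OnePoint ℝ) = 1 := rfl
    have h' : homNum (x : OnePoint ℝ) = x := rfl
    rw [h, h', if_neg one_ne_zero, div_one]

theorem homDet_ne_zero (q : BoundaryPair) :
    homNum q.1.2 * homDen q.1.1 - homNum q.1.1 * homDen q.1.2 ≠ 0 := by
  obtain ⟨⟨q₁, q₂⟩, hq⟩ := q
  simp only at hq ⊢
  induction q₁ using OnePoint.rec <;> induction q₂ using OnePoint.rec
  · exact absurd rfl hq
  · change (_ : ℝ) * 0 - 1 * 1 ≠ 0
    norm_num
  · change (1 : ℝ) * 1 - _ * 0 ≠ 0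
    norm_num
  · rename_i x y
    change y * 1 - x * 1 ≠ 0
    rw [mul_one, mul_one, sub_ne_zero]
    rintro rfl
    exact hq rfl

/-- A matrix that maps `0` and `∞` to the two given boundary points. -/
noncomputable def pairMatrix (q : BoundaryPair) : SL(2, ℝ) :=
  ⟨!![homNum q.1.2, homNum q.1.1 / (homNum q.1.2 * homDen q.1.1 - homNum q.1.1 * homDen q.1.2);
      homDen q.1.2, homDen q.1.1 / (homNum q.1.2 * homDen q.1.1 - homNum q.1.1 * homDen q.1.2)], by
    have := homDet_ne_zero q
    rw [Matrix.det_fin_two_of]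
    field_simp⟩

theorem pairMatrix_smul_zero (q : BoundaryPair) :
    pairMatrix q • ((0 : ℝ) : OnePoint ℝ) = q.1.1 := by
  have hD := homDet_ne_zero q
  conv_rhs => rw [eq_ite_homNum_div_homDen q.1.1]
  rw [smul_zero_eq]
  simp [pairMatrix, hD, div_div_div_cancel_right₀]

theorem pairMatrix_smul_infty (q : BoundaryPair) : pairMatrix q • (∞ : OnePoint ℝ) = q.1.2 := by
  conv_rhs => rw [eq_ite_homNum_div_homDen q.1.2]
  rw [smul_infty_eq]
  simp [pairMatrix]

/-- The chosen matrix in `boundaryParam` need not depend measurably on the end points; `pairMatrix`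
with the explicit shift of time yields the same geodesic by a measurable formula. -/
theorem measurable_boundaryParam : Measurable boundaryParam := by
  have hp₁ : Measurable fun x : BoundaryPair × ℝ => homNum x.1.1.1 :=
    measurable_homNum.comp (by fun_prop)
  have hp₂ : Measurable fun x : BoundaryPair × ℝ => homNum x.1.1.2 :=
    measurable_homNum.comp (by fun_prop)
  have hr₁ : Measurable fun x : BoundaryPair × ℝ => homDen x.1.1.1 :=
    measurable_homDen.comp (by fun_prop)
  have hr₂ : Measurable fun x : BoundaryPair × ℝ => homDen x.1.1.2 :=
    measurable_homDen.comp (by fun_prop)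
  have m : ∀ i j, Measurable fun x : BoundaryPair × ℝ => pairMatrix x.1 i j := by
    intro i j
    fin_cases i <;> fin_cases j <;> simp only [pairMatrix] <;> simp <;> fun_prop
  have h : boundaryParam = fun x : BoundaryPair × ℝ => geodesic (pairMatrix x.1) (x.2 + Real.log
      ((pairMatrix x.1 0 1 ^ 2 + pairMatrix x.1 1 1 ^ 2) /
        (pairMatrix x.1 0 0 ^ 2 + pairMatrix x.1 1 0 ^ 2)) / 2) := by
    funext x
    exact boundaryParam_eq_geodesic (pairMatrix_smul_zero x.1) (pairMatrix_smul_infty x.1) x.2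
  have m00 := m 0 0
  have m01 := m 0 1
  have m10 := m 1 0
  have m11 := m 1 1
  have hconj : Measurable (starRingEnd ℂ) := Complex.continuous_conj.measurable
  rw [h]
  refine Cosphere.measurable_of_coe ?_ ?_
  · simp only [coe_pt_geodesic]
    fun_prop
  · simp only [cov_geodesic]
    fun_prop

/-! ### The density -/

/-- In homogeneous coordinates a single formula covers `q₁ = ∞`; the factor `homDen q₂` supplies the
value `0` at `q₂ = ∞`. -/
theorem measurable_density (ν : ℝ) :
    Measurable fun q : OnePoint ℝ × OnePoint ℝ => density ν q.1 q.2 := by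
  have h : (fun q : OnePoint ℝ × OnePoint ℝ => density ν q.1 q.2) = fun q => homDen q.2 *
      (|homNum q.2 * homDen q.1 - homNum q.1 * homDen q.2| ^ (-2 * (ν + 1)) *
        ‖(homNum q.1 : ℂ) + homDen q.1 * Complex.I‖ ^ (2 * (ν + 1)) *
        ‖(homNum q.2 : ℂ) + Complex.I‖ ^ (2 * ν)) := by
    funext ⟨q₁, q₂⟩
    induction q₁ using OnePoint.rec <;> induction q₂ using OnePoint.rec
    · change (0 : ℝ) = 0 * _
      rw [zero_mul]
    · rename_i y
      change ‖(y : ℂ) + Complex.I‖ ^ (2 * ν) = (1 : ℝ) * (|y * 0 - 1 * 1| ^ (-2 * (ν + 1)) *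
        ‖((1 : ℝ) : ℂ) + (0 : ℝ) * Complex.I‖ ^ (2 * (ν + 1)) *
        ‖(y : ℂ) + Complex.I‖ ^ (2 * ν))
      simp
    · change (0 : ℝ) = 0 * _
      rw [zero_mul]
    · rename_i x y
      change |x - y| ^ (-2 * (ν + 1)) * ‖(x : ℂ) + Complex.I‖ ^ (2 * (ν + 1)) *
        ‖(y : ℂ) + Complex.I‖ ^ (2 * ν) = (1 : ℝ) * (|y * 1 - x * 1| ^ (-2 * (ν + 1)) *
        ‖(x : ℂ) + (1 : ℝ) * Complex.I‖ ^ (2 * (ν + 1)) *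
        ‖(y : ℂ) + Complex.I‖ ^ (2 * ν))
      simp [abs_sub_comm]
  rw [h]
  have := measurable_homNum
  have := measurable_homDen
  fun_prop

theorem norm_add_I_rpow (x s : ℝ) : ‖(x : ℂ) + Complex.I‖ ^ (2 * s) = (x ^ 2 + 1) ^ s := by
  have h := norm_sq_add_mul_I x 1
  rw [Complex.ofReal_one, one_mul] at h
  rw [Real.rpow_mul (norm_nonneg _), Real.rpow_two, h, one_pow]

/-- The density in terms of a matrix `g` that maps `∞` to `q₁` and `x` to `q₂`. -/
theorem density_smul_infty (ν : ℝ) (g : SL(2, ℝ)) {x : ℝ} (hx : g 1 0 * x + g 1 1 ≠ 0) :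
    density ν (g • (∞ : OnePoint ℝ)) (((g 0 0 * x + g 0 1) / (g 1 0 * x + g 1 1) : ℝ)) =
      (g 1 0 * x + g 1 1) ^ 2 * (g 0 0 ^ 2 + g 1 0 ^ 2) ^ (ν + 1) *
        ((g 0 0 * x + g 0 1) ^ 2 + (g 1 0 * x + g 1 1) ^ 2) ^ ν := by
  have hdet := det_eq_one g
  set L := g 1 0 * x + g 1 1 with hL
  set P := g 0 0 * x + g 0 1 with hP
  have hL2 : 0 < L ^ 2 := by positivity
  have hX : 0 < P ^ 2 + L ^ 2 := by positivity
  have e2 : ((P / L) ^ 2 + 1) ^ ν = (P ^ 2 + L ^ 2) ^ ν / (L ^ 2) ^ ν := by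
    rw [← Real.div_rpow hX.le hL2.le]; congr 1; field_simp
  rw [smul_infty_eq]
  split_ifs with hc
  · change ‖((P / L : ℝ) : ℂ) + Complex.I‖ ^ (2 * ν) = _
    have hLa : L ^ 2 * g 0 0 ^ 2 = 1 := by
      rw [hc, mul_zero, sub_zero] at hdet
      rw [hL, hc, zero_mul, zero_add, ← mul_pow, mul_comm, hdet, one_pow]
    have ha : g 0 0 ^ 2 = (L ^ 2)⁻¹ := eq_inv_of_mul_eq_one_right hLa
    rw [norm_add_I_rpow, e2, hc, zero_pow two_ne_zero, add_zero, ha, Real.rpow_add_one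
      (inv_pos.2 hL2).ne', Real.inv_rpow hL2.le]
    field_simp
  · have hc2 : 0 < g 1 0 ^ 2 := by positivity
    have hN := column_sq_pos g
    change |g 0 0 / g 1 0 - P / L| ^ (-2 * (ν + 1)) *
      ‖((g 0 0 / g 1 0 : ℝ) : ℂ) + Complex.I‖ ^ (2 * (ν + 1)) *
      ‖((P / L : ℝ) : ℂ) + Complex.I‖ ^ (2 * ν) = _
    have e0 : |g 0 0 / g 1 0 - P / L| ^ (-2 * (ν + 1)) = (g 1 0 ^ 2) ^ (ν + 1) * (L ^ 2) ^ (ν + 1) := by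
      -- Since `ad - bc = 1`, the difference `g ∞ - g x` is the reciprocal of `c (cx + d)`.
      have h1 : g 0 0 / g 1 0 - P / L = (g 1 0 * L)⁻¹ := by
        field_simp
        rw [hL, hP]; linear_combination hdet
      rw [h1, neg_mul, Real.rpow_neg (abs_nonneg _), abs_inv, Real.inv_rpow (abs_nonneg _), inv_inv,
        Real.rpow_mul (abs_nonneg _), Real.rpow_two, sq_abs, mul_pow, Real.mul_rpow hc2.le hL2.le]
    have e1 : ((g 0 0 / g 1 0) ^ 2 + 1) ^ (ν + 1) =
        (g 0 0 ^ 2 + g 1 0 ^ 2) ^ (ν + 1) / (g 1 0 ^ 2) ^ (ν + 1) := by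
      rw [← Real.div_rpow hN.le hc2.le]; congr 1; field_simp
    rw [norm_add_I_rpow, norm_add_I_rpow, e0, e1, e2, Real.rpow_add_one hL2.ne']
    field_simp

/-! ### The lift in boundary coordinates -/

theorem lintegral_comp_div {c : ℝ} (hc : 0 < c) (f : ℝ → ENNReal) :
    ∫⁻ θ, f (θ / c) = ENNReal.ofReal c * ∫⁻ x, f x := by
  have hd : ∀ x ∈ univ, HasDerivWithinAt (fun x : ℝ => c * x) c univ x := fun x _ => by
    have : HasDerivAt (fun x : ℝ => c * x) c x := by simpa using (hasDerivAt_id x).const_mul c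
    exact this.hasDerivWithinAt
  have hi : (fun x : ℝ => c * x) '' univ = univ := by
    rw [image_univ]
    exact (mul_left_surjective₀ hc.ne').range_eq
  have h := lintegral_image_eq_lintegral_abs_deriv_mul MeasurableSet.univ hd
    (mul_right_injective₀ hc.ne').injOn (fun θ => f (θ / c))
  rw [hi, setLIntegral_univ, setLIntegral_univ] at h
  rw [h, ← lintegral_const_mul' _ _ ENNReal.ofReal_ne_top]
  simp only [mul_div_cancel_left₀ _ hc.ne', abs_of_pos hc]

/-- The translate of `e^{2νr} dr dθ`, in the end point `x` and the time of the geodesics from the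
cusp. -/
theorem lintegral_cuspWeight_smul (ν : ℝ) (g : SL(2, ℝ)) {F : Cosphere → ENNReal}
    (hF : Measurable F) : ∫⁻ p, F (g • cuspCovector p.1 p.2) ∂(cuspWeight ν) =
      ENNReal.ofReal ((2 * Real.pi) ^ (2 * ν + 1)) * ∫⁻ x : ℝ, ∫⁻ s : ℝ,
        ENNReal.ofReal (Real.exp (-2 * ν * s)) * F (geodesic (g * downward x) s) := by
  have hpi := Real.two_pi_pos
  have hm : Measurable fun p : ℝ × ℝ => F (g • cuspCovector p.1 p.2) :=
    hF.comp (measurable_smul_cuspCovector g)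
  have hw : Measurable fun p : ℝ × ℝ => ENNReal.ofReal (Real.exp (2 * ν * p.1)) := by fun_prop
  rw [cuspWeight, lintegral_withDensity_eq_lintegral_mul _ hw hm, Measure.volume_eq_prod,
    lintegral_prod_symm _ (hw.mul hm).aemeasurable]
  -- The substitution `s = log (2π) - r` produces `(2π)^{2ν}`; the remaining factor `2π` comes from
  -- `θ = 2πx`.
  have h1 : ∀ θ : ℝ, ∫⁻ r, ((fun p : ℝ × ℝ => ENNReal.ofReal (Real.exp (2 * ν * p.1))) *
      fun p : ℝ × ℝ => F (g • cuspCovector p.1 p.2)) (r, θ) =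
      ENNReal.ofReal ((2 * Real.pi) ^ (2 * ν)) * ∫⁻ s, ENNReal.ofReal (Real.exp (-2 * ν * s)) *
        F (geodesic (g * downward (θ / (2 * Real.pi))) s) := by
    intro θ
    rw [← lintegral_sub_left_eq_self (fun s => ENNReal.ofReal (Real.exp (-2 * ν * s)) *
        F (geodesic (g * downward (θ / (2 * Real.pi))) s)) (Real.log (2 * Real.pi)),
      ← lintegral_const_mul' _ _ ENNReal.ofReal_ne_top]
    refine lintegral_congr fun r => ?_
    have he : Real.exp (2 * ν * r) = (2 * Real.pi) ^ (2 * ν) *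
        Real.exp (-2 * ν * (Real.log (2 * Real.pi) - r)) := by
      rw [Real.rpow_def_of_pos hpi, ← Real.exp_add]; congr 1; ring
    change ENNReal.ofReal (Real.exp (2 * ν * r)) * F (g • cuspCovector r θ) = _
    rw [he, cuspCovector_eq_geodesic, smul_geodesic, ENNReal.ofReal_mul (by positivity), mul_assoc]
  simp only [h1]
  rw [lintegral_const_mul' _ _ ENNReal.ofReal_ne_top,
    lintegral_comp_div hpi fun x => ∫⁻ s, ENNReal.ofReal (Real.exp (-2 * ν * s)) *
      F (geodesic (g * downward x) s), ← mul_assoc, ← ENNReal.ofReal_mul (by positivity),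
    Real.rpow_add_one hpi.ne']

theorem ae_linear_ne_zero {c d : ℝ} (h : c ≠ 0 ∨ d ≠ 0) : ∀ᵐ x : ℝ, c * x + d ≠ 0 := by
  by_cases hc : c = 0
  · refine ae_of_all _ fun x => ?_
    rw [hc, zero_mul, zero_add]
    exact h.resolve_left fun h => h hc
  · filter_upwards [Measure.ae_ne volume (-d / c)] with x hx h0
    refine hx ?_
    rw [eq_div_iff hc]; linarith

/-- Change of variables by a Möbius transformation of the real line. -/
theorem lintegral_moebius (g : SL(2, ℝ)) (f : ℝ → ENNReal) : ∫⁻ y, f y =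
    ∫⁻ x, ENNReal.ofReal (1 / (g 1 0 * x + g 1 1) ^ 2) *
      f ((g 0 0 * x + g 0 1) / (g 1 0 * x + g 1 1)) := by
  have hdet := det_eq_one g
  have hcd : g 1 0 ≠ 0 ∨ g 1 1 ≠ 0 := by
    by_contra! h; rw [h.1, h.2] at hdet; simp at hdet
  have hca : -g 1 0 ≠ 0 ∨ g 0 0 ≠ 0 := by
    by_contra! h; rw [neg_eq_zero] at h; rw [h.1, h.2] at hdet; simp at hdet
  set s : Set ℝ := {x | g 1 0 * x + g 1 1 ≠ 0} with hs
  have hsm : MeasurableSet s :=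
    (isOpen_ne_fun (by fun_prop) continuous_const).measurableSet
  have hd : ∀ x ∈ s, HasDerivWithinAt
      (fun x => (g 0 0 * x + g 0 1) / (g 1 0 * x + g 1 1)) (1 / (g 1 0 * x + g 1 1) ^ 2) s x := by
    intro x hx
    have h1 : HasDerivAt (fun x => g 0 0 * x + g 0 1) (g 0 0) x := by
      simpa using ((hasDerivAt_id x).const_mul (g 0 0)).add_const (g 0 1)
    have h2 : HasDerivAt (fun x => g 1 0 * x + g 1 1) (g 1 0) x := by
      simpa using ((hasDerivAt_id x).const_mul (g 1 0)).add_const (g 1 1)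
    refine ((h1.div h2 hx).congr_deriv ?_).hasDerivWithinAt
    congr 1
    linear_combination hdet
  have hinj : InjOn (fun x => (g 0 0 * x + g 0 1) / (g 1 0 * x + g 1 1)) s := by
    intro x hx y hy hxy
    simp only at hxy
    rw [div_eq_div_iff hx hy] at hxy
    linear_combination hxy - (x - y) * hdet
  have h := lintegral_image_eq_lintegral_abs_deriv_mul hsm hd hinj f
  have hs_univ : s =ᵐ[volume] univ := eventuallyEq_univ.2 (ae_linear_ne_zero hcd)
  -- The image misses at most the pole of the inverse transformation.
  have him_univ : (fun x => (g 0 0 * x + g 0 1) / (g 1 0 * x + g 1 1)) '' s =ᵐ[volume] univ := by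
    refine eventuallyEq_univ.2 ?_
    filter_upwards [ae_linear_ne_zero hca] with y hy
    have e : g 1 0 * ((g 1 1 * y - g 0 1) / (-g 1 0 * y + g 0 0)) + g 1 1 =
        1 / (-g 1 0 * y + g 0 0) := by
      rw [mul_div_assoc', div_add' _ _ _ hy]
      congr 1
      linear_combination hdet
    refine ⟨(g 1 1 * y - g 0 1) / (-g 1 0 * y + g 0 0), ?_, ?_⟩
    · change _ ≠ 0
      rw [e]; exact one_div_ne_zero hy
    · simp only
      rw [e, mul_div_assoc', div_add' _ _ _ hy, div_div_div_cancel_right₀ hy, div_one]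
      linear_combination y * hdet
  rw [setLIntegral_congr him_univ, setLIntegral_congr hs_univ, setLIntegral_univ,
    setLIntegral_univ] at h
  rw [h]
  refine lintegral_congr fun x => ?_
  rw [abs_of_nonneg (by positivity)]

/-- The contribution of a single point `q₁ = g ∞` to the lift. -/
theorem lintegral_boundaryParam_fiber (ν : ℝ) (g : SL(2, ℝ)) (F : Cosphere → ENNReal)
    {H : OnePoint ℝ × OnePoint ℝ → ENNReal} (hH : ∀ q : BoundaryPair, H q =
      ENNReal.ofReal (density ν q.1.1 q.1.2) * ∫⁻ t : ℝ, ENNReal.ofReal (Real.exp (-2 * ν * t)) *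
        F (boundaryParam (q, t))) :
    ENNReal.ofReal (1 / (g 0 0 ^ 2 + g 1 0 ^ 2) ^ (2 * ν + 1)) *
      ∫⁻ y : ℝ, H (g • (∞ : OnePoint ℝ), (y : OnePoint ℝ)) =
    ∫⁻ x : ℝ, ∫⁻ s : ℝ, ENNReal.ofReal (Real.exp (-2 * ν * s)) *
      F (geodesic (g * downward x) s) := by
  have hdet := det_eq_one g
  have hcd : g 1 0 ≠ 0 ∨ g 1 1 ≠ 0 := by
    by_contra! h; rw [h.1, h.2] at hdet; simp at hdet
  rw [lintegral_moebius g, ← lintegral_const_mul' _ _ ENNReal.ofReal_ne_top]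
  refine lintegral_congr_ae ?_
  filter_upwards [ae_linear_ne_zero hcd] with x hx
  set L := g 1 0 * x + g 1 1 with hL
  set P := g 0 0 * x + g 0 1 with hP
  have hL2 : 0 < L ^ 2 := by positivity
  have hX : 0 < P ^ 2 + L ^ 2 := by positivity
  have hN := column_sq_pos g
  set N := g 0 0 ^ 2 + g 1 0 ^ 2 with hNdef
  have e00 : (g * downward x) 0 0 = P := by
    rw [Matrix.SpecialLinearGroup.coe_mul, Matrix.mul_apply, Fin.sum_univ_two]
    simp [downward, hP]
  have e10 : (g * downward x) 1 0 = L := by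
    rw [Matrix.SpecialLinearGroup.coe_mul, Matrix.mul_apply, Fin.sum_univ_two]
    simp [downward, hL]
  have e01 : (g * downward x) 0 1 = -g 0 0 := by
    rw [Matrix.SpecialLinearGroup.coe_mul, Matrix.mul_apply, Fin.sum_univ_two]
    simp [downward]
  have e11 : (g * downward x) 1 1 = -g 1 0 := by
    rw [Matrix.SpecialLinearGroup.coe_mul, Matrix.mul_apply, Fin.sum_univ_two]
    simp [downward]
  have s0 : (g * downward x) • ((0 : ℝ) : OnePoint ℝ) = g • (∞ : OnePoint ℝ) := by
    rw [smul_zero_eq, smul_infty_eq, e01, e11]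
    simp
  have s1 : (g * downward x) • (∞ : OnePoint ℝ) = ((P / L : ℝ) : OnePoint ℝ) := by
    rw [smul_infty_eq, e00, e10, if_neg hx]
  have hne : g • (∞ : OnePoint ℝ) ≠ ((P / L : ℝ) : OnePoint ℝ) := by
    rw [← s0, ← s1, Ne, smul_left_cancel_iff]
    exact OnePoint.coe_ne_infty 0
  -- The shift in `boundaryParam_eq_geodesic` for `g * downward x`, whose columns are `(P, L)` and
  -- `(-a, -c)`.
  set τ := Real.log (N / (P ^ 2 + L ^ 2)) / 2 with hτ
  have hbp : ∀ t, boundaryParam (⟨(g • (∞ : OnePoint ℝ), ((P / L : ℝ) : OnePoint ℝ)), hne⟩, t) =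
      geodesic (g * downward x) (t + τ) := by
    intro t
    rw [boundaryParam_eq_geodesic (g := g * downward x) s0 s1, e00, e01, e10, e11, neg_sq, neg_sq]
  have hexp : ∀ t, Real.exp (-2 * ν * t) = (N / (P ^ 2 + L ^ 2)) ^ ν *
      Real.exp (-2 * ν * (t + τ)) := by
    intro t
    rw [Real.rpow_def_of_pos (by positivity), ← Real.exp_add, hτ]; congr 1; ring
  have hH' := hH ⟨(g • (∞ : OnePoint ℝ), ((P / L : ℝ) : OnePoint ℝ)), hne⟩
  simp only [hbp] at hH'
  rw [hH', density_smul_infty ν g hx]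
  have hshift : ∫⁻ t : ℝ, ENNReal.ofReal (Real.exp (-2 * ν * t)) *
      F (geodesic (g * downward x) (t + τ)) = ENNReal.ofReal ((N / (P ^ 2 + L ^ 2)) ^ ν) *
      ∫⁻ s : ℝ, ENNReal.ofReal (Real.exp (-2 * ν * s)) * F (geodesic (g * downward x) s) := by
    rw [← lintegral_add_right_eq_self (fun s => ENNReal.ofReal (Real.exp (-2 * ν * s)) *
      F (geodesic (g * downward x) s)) τ, ← lintegral_const_mul' _ _ ENNReal.ofReal_ne_top]
    refine lintegral_congr fun t => ?_
    rw [hexp t, ENNReal.ofReal_mul (by positivity), mul_assoc]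
  rw [hshift, ← mul_assoc, ← mul_assoc, ← mul_assoc, ← ENNReal.ofReal_mul (by positivity),
    ← ENNReal.ofReal_mul (by positivity), ← ENNReal.ofReal_mul (by positivity)]
  -- The factors are the weight of the atom, the Jacobian, the density and the effect of the time
  -- shift; this cancellation dictates the form of the density.
  have hone : 1 / N ^ (2 * ν + 1) * (1 / L ^ 2) * (L ^ 2 * N ^ (ν + 1) * (P ^ 2 + L ^ 2) ^ ν) *
      (N / (P ^ 2 + L ^ 2)) ^ ν = 1 := by
    have hpow : N ^ (2 * ν + 1) = N ^ (ν + 1) * N ^ ν := by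
      rw [← Real.rpow_add hN]; congr 1; ring
    rw [Real.div_rpow hN.le hX.le, hpow]
    field_simp
  rw [hone, ENNReal.ofReal_one, one_mul]

/-- Measurability is for the product σ-algebra; the two real homogeneous coordinates separate
points. -/
theorem measurableSet_ne_onePoint :
    MeasurableSet {q : OnePoint ℝ × OnePoint ℝ | q.1 ≠ q.2} := by
  have h : {q : OnePoint ℝ × OnePoint ℝ | q.1 ≠ q.2} =
      ({q | homNum q.1 = homNum q.2} ∩ {q | homDen q.1 = homDen q.2})ᶜ := by
    ext ⟨q₁, q₂⟩
    simp only [mem_ofPred_eq, mem_compl_iff, mem_inter_iff, not_iff_not]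
    refine ⟨fun h => by rw [h]; exact ⟨rfl, rfl⟩, fun ⟨h1, h2⟩ => ?_⟩
    rw [eq_ite_homNum_div_homDen q₁, eq_ite_homNum_div_homDen q₂, h1, h2]
  rw [h]
  have := measurable_homNum
  have := measurable_homDen
  exact ((measurableSet_eq_fun (by fun_prop) (by fun_prop)).inter
    (measurableSet_eq_fun (by fun_prop) (by fun_prop))).compl

theorem sFinite_comap {α β : Type*} [MeasurableSpace α] [MeasurableSpace β] {f : α → β}
    (hf : MeasurableEmbedding f) (μ : Measure β) [SFinite μ] : SFinite (μ.comap f) := by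
  refine ⟨⟨fun n => (sfiniteSeq μ n).comap f, fun n => ⟨?_⟩, ?_⟩⟩
  · rw [hf.comap_apply]; exact measure_lt_top _ _
  · ext s hs
    rw [hf.comap_apply, Measure.sum_apply _ hs]
    simp only [hf.comap_apply]
    rw [← Measure.sum_apply_of_countable, sum_sfiniteSeq]

/-- Since `muHat` is purely atomic, Fubini turns the left side into a sum over cosets, which is
compared with `liftMeasure` term by term. -/
theorem map_boundaryParam_eq_liftMeasure {Γ : Subgroup SL(2, ℝ)} {ν : ℝ}
    [IsFiniteMeasure (muHat Γ ν)] : Measure.map boundaryParam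
      (ENNReal.ofReal ((2 * Real.pi) ^ (2 * ν + 1)) • (muTilde Γ ν).prod (expMeasure ν)) =
    liftMeasure Γ ν := by
  have hval : MeasurableEmbedding (Subtype.val : BoundaryPair → OnePoint ℝ × OnePoint ℝ) := by
    refine MeasurableEmbedding.subtype_coe ?_
    exact measurableSet_ne_onePoint
  have : SFinite dq := by unfold dq; infer_instance
  have : SFinite (expMeasure ν) := by unfold expMeasure; infer_instance
  have : SFinite (((muHat Γ ν).prod dq).comap (Subtype.val : BoundaryPair → _)) :=
    sFinite_comap hval _
  have : SFinite (muTilde Γ ν) := by unfold muTilde; infer_instance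
  ext A hA
  set F : Cosphere → ENNReal := A.indicator 1 with hFdef
  have hF : Measurable F := measurable_one.indicator hA
  have hw : Measurable fun t : ℝ => ENNReal.ofReal (Real.exp (-2 * ν * t)) := by fun_prop
  have hden : Measurable fun q : BoundaryPair => ENNReal.ofReal (density ν q.1.1 q.1.2) :=
    ((measurable_density ν).comp measurable_subtype_coe).ennreal_ofReal
  have hFb : Measurable fun x : BoundaryPair × ℝ => F (boundaryParam x) :=
    hF.comp measurable_boundaryParam
  let G : BoundaryPair → ENNReal := fun q =>
    ∫⁻ t : ℝ, ENNReal.ofReal (Real.exp (-2 * ν * t)) * F (boundaryParam (q, t))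
  have hG : Measurable G := Measurable.lintegral_prod_right'
    (f := fun x : BoundaryPair × ℝ =>
      ENNReal.ofReal (Real.exp (-2 * ν * x.2)) * F (boundaryParam x))
    ((hw.comp measurable_snd).mul hFb)
  -- Extension by zero across the diagonal moves the integral from `BoundaryPair` to the full
  -- product, where Fubini applies.
  let H : OnePoint ℝ × OnePoint ℝ → ENNReal := Function.extend Subtype.val
    (fun q : BoundaryPair => ENNReal.ofReal (density ν q.1.1 q.1.2) * G q) 0
  have hHval : ∀ q : BoundaryPair, H q = ENNReal.ofReal (density ν q.1.1 q.1.2) * G q := fun q =>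
    Subtype.val_injective.extend_apply _ _ q
  have hHm : Measurable H := hval.measurable_extend (hden.mul hG) measurable_zero
  have hHzero : ∀ q ∉ range (Subtype.val : BoundaryPair → OnePoint ℝ × OnePoint ℝ), H q = 0 :=
    fun q hq => Function.extend_apply' _ _ q hq
  have hleft : ∫⁻ q, G q ∂(muTilde Γ ν) =
      ∫⁻ q₁, (∫⁻ y : ℝ, H (q₁, (y : OnePoint ℝ))) ∂(muHat Γ ν) := by
    calc ∫⁻ q, G q ∂(muTilde Γ ν)
        = ∫⁻ q : BoundaryPair, H q ∂(((muHat Γ ν).prod dq).comap Subtype.val) := by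
          rw [muTilde, lintegral_withDensity_eq_lintegral_mul _ hden hG]
          exact lintegral_congr fun q => (hHval q).symm
      _ = ∫⁻ q, H q ∂((muHat Γ ν).prod dq) := by
          rw [← hval.lintegral_map, hval.map_comap,
            ← lintegral_indicator hval.measurableSet_range]
          refine lintegral_congr fun q => ?_
          by_cases hq : q ∈ range (Subtype.val : BoundaryPair → OnePoint ℝ × OnePoint ℝ)
          · rw [indicator_of_mem hq]
          · rw [indicator_of_notMem hq, hHzero q hq]
      _ = _ := by
          rw [lintegral_prod _ hHm.aemeasurable]
          refine lintegral_congr fun q₁ => ?_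
          have hm : Measurable fun q₂ => H (q₁, q₂) := hHm.comp measurable_prodMk_left
          rw [dq, lintegral_map hm measurableEmbedding_coe_onePoint.measurable]
  rw [← lintegral_indicator_one hA, lintegral_map hF measurable_boundaryParam,
    lintegral_smul_measure, lintegral_prod _ hFb.aemeasurable]
  have hexp : ∀ q : BoundaryPair, ∫⁻ t, F (boundaryParam (q, t)) ∂(expMeasure ν) = G q := by
    intro q
    have hm : Measurable fun t => F (boundaryParam (q, t)) := hFb.comp measurable_prodMk_left
    rw [expMeasure, lintegral_withDensity_eq_lintegral_mul _ hw hm]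
    rfl
  simp only [hexp]
  rw [hleft, lintegral_muHat, smul_eq_mul, ← ENNReal.tsum_mul_left, liftMeasure,
    Measure.sum_apply _ hA]
  refine tsum_congr fun x => ?_
  rw [lintegral_boundaryParam_fiber ν (rep x) F hHval, ← lintegral_indicator_one hA,
    lintegral_map hF (measurable_smul_cuspCovector _), lintegral_cuspWeight_smul ν (rep x) hF]

end CuspLift

theorem mainTheorem5 (Γ : Subgroup SL(2, ℝ)) (hneg : -1 ∈ Γ) (hdiscrete : DiscreteTopology Γ)
    (harea : HasFiniteArea Γ)
    (hcusp : cuspStabilizer Γ = Subgroup.closure {translation, -1})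
    (R : ℝ) (hR : IsCuspRegion Γ R) (ν : ℝ) (hν : 0 < ν) :
    -- the values `a / c` are distinct for different cosets
    (Function.Injective fun x : CuspCosets Γ => rep x • (∞ : OnePoint ℝ)) ∧
    -- the weights of `muHat` are independent of the choice of representatives
    (∀ γ : Γ, (γ : SL(2, ℝ)) 0 0 ^ 2 + (γ : SL(2, ℝ)) 1 0 ^ 2 =
      rep (γ : CuspCosets Γ) 0 0 ^ 2 + rep (γ : CuspCosets Γ) 1 0 ^ 2) ∧
    -- the series defining `muHat` converges, and `muHat` is equivariant
    IsFiniteMeasure (muHat Γ ν) ∧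
    (∀ γ ∈ Γ, ∀ A : Set (OnePoint ℝ), MeasurableSet A →
      muHat Γ ν ((fun q => γ • q) '' A) =
        ∫⁻ q in A, ENNReal.ofReal (ballDeriv γ q ^ (2 * ν + 1)) ∂(muHat Γ ν)) ∧
    -- there is exactly one measure as in the definition of `μ_{jν}`, and it has exactly one lift
    ∃ μ : Measure (QuotCosphere Γ), IsCuspMeasure Γ R ν μ ∧
      (∀ μ₁, IsCuspMeasure Γ R ν μ₁ → μ₁ = μ) ∧
      ∀ μ' : Measure Cosphere, IsLift Γ μ μ' ↔
        μ' = Measure.map boundaryParam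
          (ENNReal.ofReal ((2 * Real.pi) ^ (2 * ν + 1)) • (muTilde Γ ν).prod (expMeasure ν)) := by
  have hfin := isFiniteMeasure_muHat hcusp hR hν
  refine ⟨injective_rep_smul_infty, column_sq_eq_rep hcusp, hfin,
    fun γ hγ A hA => muHat_image hcusp ν hγ hA, cuspMeasure Γ ν,
    isCuspMeasure_cuspMeasure hcusp hR hν,
    fun μ₁ h₁ => h₁.unique (isCuspMeasure_cuspMeasure hcusp hR hν), fun μ' => ?_⟩
  rw [map_boundaryParam_eq_liftMeasure]
  exact isLift_iff_eq (isLift_liftMeasure hcusp ν) μ'
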